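/- Let $\Sigma$ be a finite set with at least two elements, let $P=(p_{ik})_{i,k\in\Sigma}$ be the transition matrix of an irreducible, aperiodic Markov chain on $\Sigma$, and fix an initial state $i_0\in\Sigma$. For $\theta\in\mathbb R$ let $A(\theta)=(p_{ik}^{\theta})_{i,k\in\Sigma}$, with the convention $p_{ik}^{\theta}=0$ whenever $p_{ik}=0$, and let $\rho(\theta)\in\mathbb R$ be the maximum modulus eigenvalue of $A(\theta)$, i.e. the simple root of its characteristic polynomial whose modulus is strictly larger than that of every other complex root; it exists for every $\theta$, and $\rho$ is differentiable on $\mathbb R$. Put $$C_*:=\lim_{\theta\to-\infty}\frac{\rho(\theta)}{-\rho'(\theta)},$$ where the limit exists and $0<C_*<\infty$. Each word $u=(i_1,\dots,i_n)\in\Sigma^n$, $n\ge 0$, indexes a box of generation $n$, of size $p_{i_0i_1}p_{i_1i_2}\cdots p_{i_{n-1}i_n}$ (the box of the empty word has size $1$); only the boxes of positive size, i.e. those that correspond to possible trajectories, are considered. Balls are thrown one after the other, and their trajectories $Y^{(1)},Y^{(2)},\dots$ are independent Markov chains with transition matrix $P$ started from $i_0$; the $b$-th ball lies in the box of generation $n$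 indexed by $(Y^{(b)}_1,\dots,Y^{(b)}_n)$. For $m\ge 0$ and $j\ge1$ let the saturation level $G_{m,j}$ be the first generation at which some box contains strictly fewer than $j$ of the first $m$ balls; such a generation always exists. Then, for every $j\ge 1$, $$\lim_{m\to\infty}\frac{G_{m,j}}{\ln m}=C_*\qquad\text{almost surely.}$$ -/

import Mathlib

open MeasureTheory ProbabilityTheory Filter Topology

noncomputable section

namespace MarkovTrie

variable {S : Type*}

/-- Aperiodicity: for each state `i`, the greatest common divisor of the possible return times
`{n ≥ 1 : (P ^ n) i i > 0}` is `1`. -/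
def IsAperiodic [Fintype S] [DecidableEq S] (P : Matrix S S ℝ) : Prop :=
  ∀ (i : S) (d : ℕ), (∀ n : ℕ, 1 ≤ n → 0 < (P ^ n) i i → d ∣ n) → d = 1

/-- The matrix `A(θ)` with entries `p_{ik} ^ θ`, where vanishing entries stay `0` for every real
`θ` (also for `θ ≤ 0`). -/
def powMatrix (P : Matrix S S ℝ) (θ : ℝ) : Matrix S S ℝ :=
  open Classical in Matrix.of fun i k => if P i k = 0 then 0 else P i k ^ θ

/-- `r` is a maximum modulus eigenvalue of `A`: a simple root of the characteristic polynomial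
whose modulus is strictly larger than that of every other complex root. -/
def IsMaxModulusEigenvalue [Fintype S] [DecidableEq S] (A : Matrix S S ℝ) (r : ℂ) : Prop :=
  (A.map (algebraMap ℝ ℂ)).charpoly.rootMultiplicity r = 1 ∧
    ∀ z : ℂ, (A.map (algebraMap ℝ ℂ)).charpoly.IsRoot z → z ≠ r → ‖z‖ < ‖r‖

/-- `X` is a Markov chain on `S` with transition matrix `P` and initial state `i₀`. -/
structure IsMarkovChain [DecidableEq S] [MeasurableSpace S] {Ω : Type*} [MeasurableSpace Ω]
    (X : ℕ → Ω → S) (P : Matrix S S ℝ) (i₀ : S) (μ : Measure Ω) : Prop where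
  measurable : ∀ n, Measurable (X n)
  law : ∀ (w : ℕ → S) (n : ℕ), μ {ω | ∀ k ≤ n, X k ω = w k} =
    if w 0 = i₀ then ENNReal.ofReal (∏ k ∈ Finset.range n, P (w k) (w (k + 1))) else 0

/-- The size `p_{i₀ u₁} p_{u₁ u₂} ⋯ p_{uₙ₋₁ uₙ}` of the box of generation `n` indexed by the word
`u = (u₁, …, uₙ)`, when the root box has type `i₀` and size `1`. -/
def boxSize (P : Matrix S S ℝ) (i₀ : S) {n : ℕ} (u : Fin n → S) : ℝ :=
  ∏ k : Fin n, P ((Fin.cons i₀ u : Fin (n + 1) → S) k.castSucc) (u k)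

variable {Ω : Type*}

/-- The number of balls among the first `m` (those numbered `0, …, m - 1`) that lie in the box
indexed by `u`. Here `Y b` is the trajectory of ball `b`, so that the ball is in the box of
generation `n` indexed by `u` iff `(Y b 1, …, Y b n) = u`. -/
def ballCount (Y : ℕ → ℕ → Ω → S) (m : ℕ) {n : ℕ} (u : Fin n → S) (ω : Ω) : ℕ :=
  open Classical in ((Finset.range m).filter fun b => ∀ k : Fin n, Y b (k + 1) ω = u k).card

/-- When `m` balls have been thrown, some box of generation `n` (of positive size, i.e. one that
represents a possible trajectory) holds strictly fewer than `j` balls. -/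
def HasDeficientBox (P : Matrix S S ℝ) (i₀ : S) (Y : ℕ → ℕ → Ω → S) (m j n : ℕ) (ω : Ω) : Prop :=
  ∃ u : Fin n → S, 0 < boxSize P i₀ u ∧ ballCount Y m u ω < j

/-- The saturation level `G_{m,j}`: the first generation with a box that holds strictly fewer
than `j` balls when `m` balls have been thrown. -/
def saturationLevel (P : Matrix S S ℝ) (i₀ : S) (Y : ℕ → ℕ → Ω → S) (m j : ℕ) (ω : Ω) : ℕ :=
  sInf {n : ℕ | HasDeficientBox P i₀ Y m j n ω}

end MarkovTrie

end

/-! ### Perron–Frobenius theory for primitive real matrices. -/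

namespace Matrix

variable {S : Type*} [Fintype S] {A : Matrix S S ℝ}

/-! The saturation level is governed by the smallest possible box of generation `n`, whose size is
`exp (-n (l + o(1)))`, where `l` is the limit of `-ρ'/ρ` at `-∞`. With more than `exp (n (l + δ))`
balls every possible box is well filled; with fewer than `exp (n (l - δ))` balls the smallest one is
still empty. Hence `G` grows like `log m / l`, and `C = l⁻¹`.

The exponent comes from `A(-s)` for large `s`. Raised to the power `-s`, a box size is the weight of
one path in `A(-s)^n`, so it is at most of order `ρ(-s)^n`. There are at most `K ^ n` paths, `K`
being the number of states, so some path has weight at least of order `(ρ(-s) / K)^n`. Taking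
`-1/s`-th powers brackets the smallest size, and the factor `K` only shifts the exponent by `log K /
s` (`exists_le_boxSize`, `exists_boxSize_le`). Since `log ρ` lies above its tangents
(`log_add_mul_meanLog_le`), `log ρ(-s) / s` and `-ρ'/ρ` have the same limit
(`exists_asymptotic_slope`).

Both probabilistic bounds use Borel–Cantelli along `n`: a union bound over the `K ^ n` words with
doubly exponentially small failure probabilities, and a first moment bound for one small box.
Monotonicity of deficiency in the generation and in the number of balls carries them over to all
`m`. -/

lemma mulVec_pos {B : Matrix S S ℝ} (hB : ∀ i j, 0 < B i j) {x : S → ℝ} (hx : ∀ i, 0 ≤ x i)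
    (hx0 : ∃ i, 0 < x i) (i : S) : 0 < (B *ᵥ x) i := by
  obtain ⟨k, hk⟩ := hx0
  exact Finset.sum_pos' (fun j _ => mul_nonneg (hB i j).le (hx j))
    ⟨k, Finset.mem_univ _, mul_pos (hB i k) hk⟩

/-- `r` is a positive eigenvalue of `A` with positive right and left eigenvectors `v` and `w`. -/
structure IsPerron (A : Matrix S S ℝ) (r : ℝ) (v w : S → ℝ) : Prop where
  pos : 0 < r
  right_pos : ∀ i, 0 < v i
  left_pos : ∀ i, 0 < w i
  right_sum : ∑ i, v i = 1
  right_eq : A *ᵥ v = r • v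
  left_eq : w ᵥ* A = r • w

lemma dotProduct_pos_of_pos [Nonempty S] {v w : S → ℝ} (hv : ∀ i, 0 < v i) (hw : ∀ i, 0 < w i) :
    0 < w ⬝ᵥ v :=
  Finset.sum_pos (fun i _ => mul_pos (hw i) (hv i)) Finset.univ_nonempty

namespace IsPerron

variable {r : ℝ} {v w : S → ℝ}

lemma left_mul_sum (h : IsPerron A r v w) (u : S → ℂ) :
    ∑ i, (w i : ℂ) * (A.map (algebraMap ℝ ℂ) *ᵥ u) i = r * ∑ i, (w i : ℂ) * u i := by
  have hw : ∀ j, ∑ i, (w i : ℂ) * (A i j : ℂ) = r * w j := fun j => by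
    have := congrFun h.left_eq j
    simp only [vecMul, dotProduct, Pi.smul_apply, smul_eq_mul] at this
    exact_mod_cast this
  simp only [mulVec, dotProduct, map_apply, Complex.coe_algebraMap, Finset.mul_sum]
  rw [Finset.sum_comm]
  refine Finset.sum_congr rfl fun j _ => ?_
  rw [← mul_assoc, ← hw j, Finset.sum_mul]
  exact Finset.sum_congr rfl fun i _ => by ring

lemma right_eq_complex (h : IsPerron A r v w) :
    A.map (algebraMap ℝ ℂ) *ᵥ (fun i => (v i : ℂ)) = (r : ℂ) • fun i => (v i : ℂ) := by
  funext i
  have := congrFun h.right_eq i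
  simp only [mulVec, dotProduct, Pi.smul_apply, smul_eq_mul, map_apply,
    Complex.coe_algebraMap] at this ⊢
  exact_mod_cast this

end IsPerron

variable [DecidableEq S]

lemma pow_apply_pos_of_pos {P A : Matrix S S ℝ} (hP : ∀ i j, 0 ≤ P i j) (hA : ∀ i j, 0 ≤ A i j)
    (h : ∀ i j, 0 < P i j → 0 < A i j) (n : ℕ) {i j : S} (hij : 0 < (P ^ n) i j) :
    0 < (A ^ n) i j := by
  induction n generalizing j with
  | zero => simpa using hij
  | succ n ih =>
    rw [pow_succ, mul_apply] at hij ⊢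
    obtain ⟨l, hl, hpos⟩ := (Finset.sum_pos_iff_of_nonneg
      (fun x _ => mul_nonneg (pow_apply_nonneg hP n i x) (hP x j))).1 hij
    refine (Finset.sum_pos_iff_of_nonneg
      (fun x _ => mul_nonneg (pow_apply_nonneg hA n i x) (hA x j))).2 ⟨l, hl, ?_⟩
    have h1 := pos_of_mul_pos_left hpos (hP l j)
    have h2 := pos_of_mul_pos_right hpos (pow_apply_nonneg hP n i l)
    exact mul_pos (ih h1) (h _ _ h2)

lemma pow_add_apply_pos (hA : ∀ i j, 0 ≤ A i j) {m n : ℕ} {i j k : S}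
    (h1 : 0 < (A ^ m) i j) (h2 : 0 < (A ^ n) j k) : 0 < (A ^ (m + n)) i k := by
  rw [pow_add, mul_apply]
  exact (Finset.sum_pos_iff_of_nonneg
      (fun x _ => mul_nonneg (pow_apply_nonneg hA m i x) (pow_apply_nonneg hA n x k))).2
      ⟨j, Finset.mem_univ _, mul_pos h1 h2⟩

/-- Return times to a state are closed under addition and have gcd `1`, so they contain all large
integers; appending one path from `i` to `j` covers every pair, and finiteness gives a common
exponent. -/
theorem IsIrreducible.isPrimitive (hirr : A.IsIrreducible) (haper : MarkovTrie.IsAperiodic A) :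
    A.IsPrimitive := by
  have hA := hirr.nonneg
  refine ⟨hA, ?_⟩
  have hreturn : ∀ i, ∃ N, ∀ n ≥ N, 0 < (A ^ n) i i := by
    intro i
    set R : Set ℕ := {n | 1 ≤ n ∧ 0 < (A ^ n) i i}
    have hgcd : Nat.setGcd R = 1 :=
      haper i _ fun n h1 h2 => Nat.setGcd_dvd_of_mem (s := R) ⟨h1, h2⟩
    obtain ⟨N, hN⟩ := Nat.exists_mem_closure_of_ge R
    refine ⟨N, fun n hn => ?_⟩
    have hmem := hN n hn (by simp [hgcd])
    clear hn
    induction hmem using AddSubmonoid.closure_induction with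
    | mem x hx => exact hx.2
    | zero => simp
    | add x y _ _ hx hy => exact pow_add_apply_pos hA hx hy
  have hpair : ∀ p : S × S, ∃ N, ∀ n ≥ N, 0 < (A ^ n) p.1 p.2 := by
    rintro ⟨i, j⟩
    obtain ⟨N, hN⟩ := hreturn i
    obtain ⟨k, -, hk⟩ := (isIrreducible_iff_exists_pow_pos hA).1 hirr i j
    refine ⟨N + k, fun n hn => ?_⟩
    obtain ⟨t, rfl⟩ := Nat.exists_eq_add_of_le hn
    rw [show N + k + t = (N + t) + k by ring]
    exact pow_add_apply_pos hA (hN _ (by omega)) hk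
  choose N hN using hpair
  refine ⟨Finset.univ.sup N + 1, Nat.succ_pos _, fun i j => hN (i, j) _ ?_⟩
  exact (Finset.le_sup (Finset.mem_univ (i, j))).trans (Nat.le_succ _)

lemma pow_mulVec_of_mulVec_eq_smul {R : Type*} [CommRing R] {A : Matrix S S R} {v : S → R} {r : R}
    (h : A *ᵥ v = r • v) (n : ℕ) : (A ^ n) *ᵥ v = r ^ n • v := by
  induction n with
  | zero => simp
  | succ n ih => rw [pow_succ, ← mulVec_mulVec, h, mulVec_smul, ih, smul_smul, pow_succ']

lemma vecMul_pow_of_vecMul_eq_smul {R : Type*} [CommRing R] {A : Matrix S S R} {w : S → R} {r : R}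
    (h : w ᵥ* A = r • w) (n : ℕ) : w ᵥ* (A ^ n) = r ^ n • w := by
  induction n with
  | zero => simp
  | succ n ih => rw [pow_succ, ← vecMul_vecMul, ih, smul_vecMul, h, smul_smul, pow_succ]

/-- Collatz–Wielandt: maximise `t` over the compact set of pairs `(t, x)` with `x` in the simplex
and `t x ≤ A x`. The maximiser is an eigenpair. -/
theorem IsPrimitive.exists_right_eigenvector [Nonempty S] (hA : A.IsPrimitive) :
    ∃ (r : ℝ) (v : S → ℝ), 0 < r ∧ (∀ i, 0 < v i) ∧ ∑ i, v i = 1 ∧ A *ᵥ v = r • v := by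
  obtain ⟨k, hk, hB⟩ := hA.exists_pos_pow
  set B := A ^ k with hBdef
  set M := ∑ i, ∑ j, A i j with hM
  set T : Set (ℝ × (S → ℝ)) :=
    (Set.Icc 0 M ×ˢ stdSimplex ℝ S) ∩ {p | ∀ i, p.1 * p.2 i ≤ (A *ᵥ p.2) i} with hT
  have hbound : ∀ (t : ℝ) (x : S → ℝ), x ∈ stdSimplex ℝ S → (∀ i, t * x i ≤ (A *ᵥ x) i) →
      t ≤ M := by
    intro t x hx h
    calc t = ∑ i, t * x i := by rw [← Finset.mul_sum, hx.2, mul_one]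
      _ ≤ ∑ i, (A *ᵥ x) i := Finset.sum_le_sum fun i _ => h i
      _ ≤ M := by
        refine Finset.sum_le_sum fun i _ => Finset.sum_le_sum fun j _ => ?_
        have : x j ≤ 1 := hx.2 ▸ Finset.single_le_sum (fun i _ => hx.1 i) (Finset.mem_univ j)
        exact mul_le_of_le_one_right (hA.nonneg i j) this
  have hTc : IsCompact T := by
    refine (isCompact_Icc.prod (isCompact_stdSimplex ℝ S)).inter_right ?_
    simp only [Set.ofPred_forall]
    refine isClosed_iInter fun i => isClosed_le (by fun_prop) ?_
    simp only [mulVec, dotProduct]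
    fun_prop
  have hTne : T.Nonempty := by
    obtain ⟨x, hx⟩ := (Set.Nonempty.of_subtype : (stdSimplex ℝ S).Nonempty)
    refine ⟨(0, x), ⟨⟨⟨le_rfl, ?_⟩, hx⟩, fun i => ?_⟩⟩
    · exact Finset.sum_nonneg fun i _ => Finset.sum_nonneg fun j _ => hA.nonneg i j
    · simp only [zero_mul]
      exact Finset.sum_nonneg fun j _ => mul_nonneg (hA.nonneg i j) (hx.1 j)
  obtain ⟨⟨r, x⟩, ⟨⟨⟨hr0, -⟩, hx⟩, hle⟩, hmax⟩ := hTc.exists_isMaxOn hTne continuous_fst.continuousOn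
  simp only [Set.mem_ofPred_eq] at hr0 hle hx
  have hxpos : ∃ i, 0 < x i := by
    by_contra! h
    have := Finset.sum_nonpos fun i (_ : i ∈ Finset.univ) => h i
    rw [hx.2] at this
    linarith
  have heq : A *ᵥ x = r • x := by
    by_contra hne
    set d := A *ᵥ x - r • x with hd
    have hd0 : ∀ i, 0 ≤ d i := fun i => by simpa [hd] using hle i
    have hdpos : ∃ i, 0 < d i := by
      by_contra! h
      exact hne (sub_eq_zero.1 (funext fun i => le_antisymm (h i) (hd0 i)))
    -- Applying the positive matrix `B` turns the nonzero defect `d ≥ 0` into a strictly positive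
    -- one, so `y`, once normalised, admits the larger value `r + ε`.
    set y := B *ᵥ x with hy
    have hypos := mulVec_pos hB hx.1 hxpos
    have hBd := mulVec_pos hB hd0 hdpos
    have hAy : A *ᵥ y = r • y + B *ᵥ d := by
      rw [hd, mulVec_sub, mulVec_smul, hy, mulVec_mulVec, mulVec_mulVec, hBdef, ← pow_succ,
        ← pow_succ']
      abel
    obtain ⟨i₁, hi₁⟩ := Finite.exists_min fun i => (B *ᵥ d) i / y i
    set ε := (B *ᵥ d) i₁ / y i₁
    have hε : 0 < ε := div_pos (hBd _) (hypos _)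
    set s := ∑ i, y i
    have hs : 0 < s := Finset.sum_pos (fun i _ => hypos i) Finset.univ_nonempty
    have hz : s⁻¹ • y ∈ stdSimplex ℝ S := by
      refine ⟨fun i => mul_nonneg (inv_nonneg.2 hs.le) (hypos i).le, ?_⟩
      simp only [Pi.smul_apply, smul_eq_mul, ← Finset.mul_sum]
      exact inv_mul_cancel₀ hs.ne'
    have hzle : ∀ i, (r + ε) * (s⁻¹ • y) i ≤ (A *ᵥ (s⁻¹ • y)) i := by
      intro i
      rw [mulVec_smul, hAy]
      simp only [Pi.smul_apply, smul_eq_mul, Pi.add_apply]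
      have := (le_div_iff₀ (hypos i)).1 (hi₁ i)
      have h2 := mul_le_mul_of_nonneg_left this (inv_nonneg.2 hs.le)
      linarith
    have := hmax (a := (r + ε, s⁻¹ • y))
      ⟨⟨⟨by positivity, hbound _ _ hz hzle⟩, hz⟩, hzle⟩
    simp only [Set.mem_ofPred_eq] at this
    linarith
  have hBx := mulVec_pos hB hx.1 hxpos
  rw [hBdef, pow_mulVec_of_mulVec_eq_smul heq] at hBx
  have hr : 0 < r := by
    refine hr0.lt_of_ne fun h => ?_
    have := hBx hxpos.choose
    simp [← h, hk.ne'] at this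
  refine ⟨r, x, hr, fun i => ?_, hx.2, heq⟩
  exact pos_of_mul_pos_right (hBx i) (pow_pos hr k).le

lemma IsPrimitive.transpose (hA : A.IsPrimitive) : Aᵀ.IsPrimitive := by
  obtain ⟨k, hk, hB⟩ := hA.exists_pos_pow
  exact ⟨fun i j => hA.nonneg j i, k, hk, fun i j => by rw [← transpose_pow]; exact hB j i⟩

/-- The left vector is a right eigenvector of the transpose; evaluating `w A v` in two ways, with `w
⬝ᵥ v > 0`, identifies the two eigenvalues. -/
theorem IsPrimitive.exists_isPerron [Nonempty S] (hA : A.IsPrimitive) :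
    ∃ r v w, IsPerron A r v w := by
  obtain ⟨r, v, hr, hv, hs, h⟩ := hA.exists_right_eigenvector
  obtain ⟨r', w, -, hw, -, h'⟩ := hA.transpose.exists_right_eigenvector
  rw [mulVec_transpose] at h'
  have h1 : r' * (w ⬝ᵥ v) = r * (w ⬝ᵥ v) := by
    rw [← smul_eq_mul, ← smul_eq_mul, ← smul_dotProduct, ← h', ← dotProduct_mulVec, h,
      dotProduct_smul]
  have hrr : r' = r := mul_right_cancel₀ (dotProduct_pos_of_pos hv hw).ne' h1
  exact ⟨r, v, w, hr, hv, hw, hs, h, hrr ▸ h'⟩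

namespace IsPerron

variable {r : ℝ} {v w : S → ℝ}

/-- Eigenvectors annihilated by the left Perron vector have an eigenvalue of smaller modulus. -/
theorem norm_lt_of_dotProduct_eq_zero [Nonempty S] (h : IsPerron A r v w) (hA : A.IsPrimitive)
    {z : ℂ} {u : S → ℂ} (hu : A.map (algebraMap ℝ ℂ) *ᵥ u = z • u)
    (hwu : ∑ i, (w i : ℂ) * u i = 0) (hu0 : u ≠ 0) : ‖z‖ < r := by
  obtain ⟨k, hk, hB⟩ := hA.exists_pos_pow
  set B := A ^ k with hBdef
  -- The largest `ε` for which `B - ε v wᵀ` is entrywise nonnegative. As `w` annihilates `u`, the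
  -- rank-one term does not change `B u`, yet it lowers the `w`-weighted norm bound from `r ^ k` to
  -- `r ^ k - ε (w ⬝ᵥ v)`.
  obtain ⟨p, hp⟩ := Finite.exists_min fun p : S × S => B p.1 p.2 / (v p.1 * w p.2)
  set ε := B p.1 p.2 / (v p.1 * w p.2)
  have hε : 0 < ε := div_pos (hB _ _) (mul_pos (h.right_pos _) (h.left_pos _))
  have hεB : ∀ i j, 0 ≤ B i j - ε * (v i * w j) := fun i j =>
    sub_nonneg.2 ((le_div_iff₀ (mul_pos (h.right_pos _) (h.left_pos _))).1 (hp (i, j)))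
  have hBu : ∀ i, z ^ k * u i = ∑ j, (B i j : ℂ) * u j := by
    intro i
    have := congrFun (pow_mulVec_of_mulVec_eq_smul hu k) i
    rw [← Matrix.map_pow] at this
    simpa [mulVec, dotProduct, hBdef] using this.symm
  have hnorm : ∀ i, ‖z‖ ^ k * ‖u i‖ ≤ ∑ j, (B i j - ε * (v i * w j)) * ‖u j‖ := by
    intro i
    have h1 : z ^ k * u i = ∑ j, ((B i j - ε * (v i * w j) : ℝ) : ℂ) * u j := by
      have : ∑ j, ((B i j - ε * (v i * w j) : ℝ) : ℂ) * u j
          = ∑ j, (B i j : ℂ) * u j - ε * v i * ∑ j, (w j : ℂ) * u j := by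
        rw [Finset.mul_sum, ← Finset.sum_sub_distrib]
        refine Finset.sum_congr rfl fun j _ => ?_
        push_cast
        ring
      rw [this, hwu, hBu i]
      ring
    rw [← norm_pow, ← norm_mul, h1]
    refine (norm_sum_le _ _).trans (Finset.sum_le_sum fun j _ => ?_)
    rw [norm_mul, Complex.norm_real, Real.norm_of_nonneg (hεB i j)]
  set W := ∑ i, w i * ‖u i‖ with hW
  have hWpos : 0 < W := by
    obtain ⟨i, hi⟩ := Function.ne_iff.1 hu0
    exact Finset.sum_pos' (fun i _ => mul_nonneg (h.left_pos i).le (norm_nonneg _))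
      ⟨i, Finset.mem_univ _, mul_pos (h.left_pos i) (norm_pos_iff.2 hi)⟩
  have hwB : ∀ j, ∑ i, w i * B i j = r ^ k * w j := fun j => by
    simpa [vecMul, dotProduct] using congrFun (vecMul_pow_of_vecMul_eq_smul h.left_eq k) j
  have hkey : ‖z‖ ^ k * W ≤ (r ^ k - ε * (w ⬝ᵥ v)) * W := by
    calc ‖z‖ ^ k * W = ∑ i, w i * (‖z‖ ^ k * ‖u i‖) := by
          rw [hW, Finset.mul_sum]; exact Finset.sum_congr rfl fun i _ => by ring
      _ ≤ ∑ i, w i * ∑ j, (B i j - ε * (v i * w j)) * ‖u j‖ :=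
          Finset.sum_le_sum fun i _ => mul_le_mul_of_nonneg_left (hnorm i) (h.left_pos i).le
      _ = ∑ j, (∑ i, w i * B i j - ε * (∑ i, w i * v i) * w j) * ‖u j‖ := by
          simp_rw [Finset.mul_sum, Finset.sum_mul, ← Finset.sum_sub_distrib, Finset.sum_mul]
          rw [Finset.sum_comm]
          exact Finset.sum_congr rfl fun j _ => Finset.sum_congr rfl fun i _ => by ring
      _ = (r ^ k - ε * (w ⬝ᵥ v)) * W := by
          change ∑ j, (∑ i, w i * B i j - ε * (w ⬝ᵥ v) * w j) * ‖u j‖ = _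
          rw [hW, Finset.mul_sum]
          refine Finset.sum_congr rfl fun j _ => ?_
          rw [hwB j]
          ring
  have h2 := le_of_mul_le_mul_right hkey hWpos
  have h3 := mul_pos hε (dotProduct_pos_of_pos h.right_pos h.left_pos)
  exact lt_of_pow_lt_pow_left₀ k h.pos.le (by linarith)

/-- The eigenspace of the Perron eigenvalue is spanned by the right Perron vector. -/
theorem exists_eq_smul [Nonempty S] (h : IsPerron A r v w) (hA : A.IsPrimitive) {u : S → ℂ}
    (hu : A.map (algebraMap ℝ ℂ) *ᵥ u = (r : ℂ) • u) : ∃ c : ℂ, u = c • fun i => (v i : ℂ) := by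
  have hwv : ((w ⬝ᵥ v : ℝ) : ℂ) ≠ 0 :=
    Complex.ofReal_ne_zero.2 (dotProduct_pos_of_pos h.right_pos h.left_pos).ne'
  -- This `c` makes `u - c v` orthogonal to `w`; if nonzero, it would give `r < r`.
  set c : ℂ := (∑ i, (w i : ℂ) * u i) / ((w ⬝ᵥ v : ℝ) : ℂ) with hc
  refine ⟨c, sub_eq_zero.1 ?_⟩
  by_contra hne
  have := h.norm_lt_of_dotProduct_eq_zero hA (z := r) (u := u - c • fun i => (v i : ℂ)) ?_ ?_ hne
  · rw [Complex.norm_real, Real.norm_of_nonneg h.pos.le] at this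
    exact lt_irrefl _ this
  · rw [mulVec_sub, mulVec_smul, hu, h.right_eq_complex, smul_sub, smul_comm]
  · simp only [Pi.sub_apply, Pi.smul_apply, smul_eq_mul, mul_sub, Finset.sum_sub_distrib]
    have : ∑ i, (w i : ℂ) * (c * v i) = c * ((w ⬝ᵥ v : ℝ) : ℂ) := by
      simp only [dotProduct, Complex.ofReal_sum, Complex.ofReal_mul, Finset.mul_sum]
      exact Finset.sum_congr rfl fun i _ => by ring
    rw [this, hc, div_mul_cancel₀ _ hwv, sub_self]

theorem right_unique [Nonempty S] (h : IsPerron A r v w) (hA : A.IsPrimitive) {u : S → ℝ}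
    (hu : A *ᵥ u = r • u) (hsum : ∑ i, u i = 1) : u = v := by
  have huc : A.map (algebraMap ℝ ℂ) *ᵥ (fun i => (u i : ℂ)) = (r : ℂ) • fun i => (u i : ℂ) := by
    funext i
    have := congrFun hu i
    simp only [mulVec, dotProduct, Pi.smul_apply, smul_eq_mul, map_apply,
      Complex.coe_algebraMap] at this ⊢
    exact_mod_cast this
  obtain ⟨c, hc⟩ := h.exists_eq_smul hA huc
  have hc1 : c = 1 := by
    have h1 : ∑ i, (u i : ℂ) = 1 := by exact_mod_cast hsum
    have h2 : ∑ i, (v i : ℂ) = 1 := by exact_mod_cast h.right_sum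
    have h3 : ∑ i, (u i : ℂ) = c * ∑ i, (v i : ℂ) := by
      rw [Finset.mul_sum]
      exact Finset.sum_congr rfl fun i _ => congrFun hc i
    rw [h1, h2, mul_one] at h3
    exact h3.symm
  funext i
  have := congrFun hc i
  simpa [hc1] using this

/-- The root multiplicity is the dimension of the generalised eigenspace. There is no Jordan block:
pairing `(A - r) u = c v` with `w` forces `c = 0`. For `z ≠ r`, the same pairing shows that
eigenvectors are orthogonal to `w`. -/
theorem isMaxModulusEigenvalue [Nonempty S] (h : IsPerron A r v w) (hA : A.IsPrimitive) :
    MarkovTrie.IsMaxModulusEigenvalue A (r : ℂ) := by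
  set A' := A.map (algebraMap ℝ ℂ) with hA'
  have hcp : A'.charpoly = (toLin' A').charpoly := (Matrix.charpoly_toLin' A').symm
  refine ⟨?_, fun z hz hne => ?_⟩
  · rw [← hA', hcp, ← LinearMap.finrank_maxGenEigenspace_eq]
    have hspan : Module.End.maxGenEigenspace (toLin' A') (r : ℂ) = ℂ ∙ fun i => (v i : ℂ) := by
      refine le_antisymm (fun u hu => ?_) ?_
      · obtain ⟨k, hk⟩ := Module.End.mem_maxGenEigenspace _ _ _ |>.1 hu
        clear hu
        induction k generalizing u with
        | zero =>
          have : u = 0 := by simpa using hk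
          simp [this]
        | succ k ih =>
          rw [pow_succ, Module.End.mul_apply] at hk
          obtain ⟨c, hc⟩ := Submodule.mem_span_singleton.1 (ih _ hk)
          have hc' : A' *ᵥ u - (r : ℂ) • u = c • fun i => (v i : ℂ) := by
            rw [hc]; simp
          have hsum := congrArg (fun x : S → ℂ => ∑ i, (w i : ℂ) * x i) hc'
          simp only [Pi.sub_apply, Pi.smul_apply, smul_eq_mul, mul_sub,
            Finset.sum_sub_distrib] at hsum
          rw [h.left_mul_sum u] at hsum
          have h1 : ∑ i, (w i : ℂ) * (r * u i) = r * ∑ i, (w i : ℂ) * u i := by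
            rw [Finset.mul_sum]; exact Finset.sum_congr rfl fun i _ => by ring
          have h2 : ∑ i, (w i : ℂ) * (c * v i) = c * ((w ⬝ᵥ v : ℝ) : ℂ) := by
            simp only [dotProduct, Complex.ofReal_sum, Complex.ofReal_mul, Finset.mul_sum]
            exact Finset.sum_congr rfl fun i _ => by ring
          rw [h1, sub_self, h2] at hsum
          have hc0 : c = 0 := (mul_eq_zero.1 hsum.symm).resolve_right
            (Complex.ofReal_ne_zero.2 (dotProduct_pos_of_pos h.right_pos h.left_pos).ne')
          rw [hc0, zero_smul, sub_eq_zero] at hc'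
          obtain ⟨d, hd⟩ := h.exists_eq_smul hA hc'
          exact Submodule.mem_span_singleton.2 ⟨d, hd.symm⟩
      · rw [Submodule.span_singleton_le_iff_mem]
        refine (Module.End.mem_maxGenEigenspace _ _ _).2 ⟨1, ?_⟩
        rw [pow_one, LinearMap.sub_apply, toLin'_apply, hA', h.right_eq_complex]
        simp
    rw [hspan]
    refine finrank_span_singleton fun h0 => ?_
    have := congrFun h0 (Classical.arbitrary S)
    exact (h.right_pos _).ne' (by simpa using this)
  · rw [← hA', hcp] at hz
    have hev : Module.End.HasEigenvalue (toLin' A') z := 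
      (Module.End.hasEigenvalue_iff_isRoot_charpoly _ _).2 hz
    obtain ⟨u, hu, hu0⟩ := hev.exists_hasEigenvector
    rw [Module.End.mem_eigenspace_iff, toLin'_apply] at hu
    rw [Complex.norm_real, Real.norm_of_nonneg h.pos.le]
    refine h.norm_lt_of_dotProduct_eq_zero hA hu ?_ hu0
    have h1 := h.left_mul_sum u
    rw [← hA', hu] at h1
    have h2 : ∑ i, (w i : ℂ) * (z • u) i = z * ∑ i, (w i : ℂ) * u i := by
      rw [Finset.mul_sum]
      exact Finset.sum_congr rfl fun i _ => by simp only [Pi.smul_apply, smul_eq_mul]; ring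
    rw [h2] at h1
    by_contra hne0
    exact hne (mul_right_cancel₀ hne0 h1)

end IsPerron

end Matrix

/-! ### Tangents, continuity and differentiability of the Perron eigenvalue in `θ`. -/

namespace MarkovTrie

open Matrix

variable {S : Type*} {P : Matrix S S ℝ}

lemma powMatrix_of_pos {i j : S} (h : 0 < P i j) (θ : ℝ) : powMatrix P θ i j = P i j ^ θ := by
  simp [powMatrix, h.ne']

lemma powMatrix_of_eq_zero {i j : S} (h : P i j = 0) (θ : ℝ) : powMatrix P θ i j = 0 := by
  simp [powMatrix, h]

lemma powMatrix_nonneg (hP : ∀ i j, 0 ≤ P i j) (θ : ℝ) (i j : S) : 0 ≤ powMatrix P θ i j := by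
  rcases (hP i j).eq_or_lt with h | h
  · rw [powMatrix_of_eq_zero h.symm]
  · rw [powMatrix_of_pos h]
    exact (Real.rpow_pos_of_pos h θ).le

lemma powMatrix_pos {i j : S} (h : 0 < P i j) (θ : ℝ) : 0 < powMatrix P θ i j := by
  rw [powMatrix_of_pos h]
  exact Real.rpow_pos_of_pos h θ

lemma powMatrix_one (P : Matrix S S ℝ) : powMatrix P 1 = P := by
  ext i j
  by_cases h : P i j = 0 <;> simp [powMatrix, h]

lemma hasDerivAt_powMatrix (hP : ∀ i j, 0 ≤ P i j) (θ : ℝ) (i j : S) :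
    HasDerivAt (fun t => powMatrix P t i j) (powMatrix P θ i j * Real.log (P i j)) θ := by
  rcases (hP i j).eq_or_lt with h | h
  · simpa [powMatrix_of_eq_zero h.symm] using hasDerivAt_const θ (0 : ℝ)
  · simp only [powMatrix_of_pos h]
    exact Real.hasStrictDerivAt_const_rpow h θ |>.hasDerivAt

variable [Fintype S]

/-- The stationary edge measure of the chain obtained from `A` by Perron normalization. -/
noncomputable def edgeMeasure (A : Matrix S S ℝ) (r : ℝ) (v w : S → ℝ) (i j : S) : ℝ :=
  w i * A i j * v j / (r * (w ⬝ᵥ v))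

/-- The mean of `log P` under the stationary edge measure. -/
noncomputable def meanLog (P A : Matrix S S ℝ) (r : ℝ) (v w : S → ℝ) : ℝ :=
  ∑ i, ∑ j, edgeMeasure A r v w i j * Real.log (P i j)

section EdgeMeasure

variable {A : Matrix S S ℝ} {r : ℝ} {v w : S → ℝ} [Nonempty S]

lemma edgeMeasure_nonneg (hA : ∀ i j, 0 ≤ A i j) (h : IsPerron A r v w) (i j : S) :
    0 ≤ edgeMeasure A r v w i j :=
  div_nonneg (mul_nonneg (mul_nonneg (h.left_pos i).le (hA i j)) (h.right_pos j).le)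
    (mul_pos h.pos (dotProduct_pos_of_pos h.right_pos h.left_pos)).le

lemma sum_edgeMeasure_right (h : IsPerron A r v w) (i : S) :
    ∑ j, edgeMeasure A r v w i j = w i * v i / (w ⬝ᵥ v) := by
  have h1 : ∑ j, A i j * v j = r * v i := congrFun h.right_eq i
  have h2 := (dotProduct_pos_of_pos h.right_pos h.left_pos).ne'
  have h3 := h.pos.ne'
  simp only [edgeMeasure, ← Finset.sum_div, mul_assoc, ← Finset.mul_sum, h1]
  field_simp

lemma sum_edgeMeasure_left (h : IsPerron A r v w) (j : S) :
    ∑ i, edgeMeasure A r v w i j = w j * v j / (w ⬝ᵥ v) := by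
  have h1 : ∑ i, w i * A i j = r * w j := congrFun h.left_eq j
  have h2 := (dotProduct_pos_of_pos h.right_pos h.left_pos).ne'
  have h3 := h.pos.ne'
  simp only [edgeMeasure, ← Finset.sum_div, ← Finset.sum_mul, h1]
  field_simp

lemma sum_edgeMeasure (h : IsPerron A r v w) : ∑ i, ∑ j, edgeMeasure A r v w i j = 1 := by
  simp only [sum_edgeMeasure_right h, ← Finset.sum_div]
  exact div_self (dotProduct_pos_of_pos h.right_pos h.left_pos).ne'

/-- Stationarity: both marginals of the edge measure are `w i * v i / (w ⬝ᵥ v)`, so coboundaries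
have mean zero. -/
lemma sum_edgeMeasure_mul_sub (h : IsPerron A r v w) (g : S → ℝ) :
    ∑ i, ∑ j, edgeMeasure A r v w i j * (g j - g i) = 0 := by
  simp only [mul_sub, Finset.sum_sub_distrib, ← Finset.sum_mul, sum_edgeMeasure_right h]
  rw [Finset.sum_comm]
  simp only [← Finset.sum_mul, sum_edgeMeasure_left h]
  exact sub_self _

end EdgeMeasure

section Gibbs

variable [Nonempty S] {r r' θ θ' : ℝ} {v v' w w' : S → ℝ}

/-- The function `log ρ` lies above its tangents; `meanLog` is the slope. -/
theorem log_add_mul_meanLog_le (hP : ∀ i j, 0 ≤ P i j) (h : IsPerron (powMatrix P θ) r v w)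
    (h' : IsPerron (powMatrix P θ') r' v' w') :
    Real.log r + (θ' - θ) * meanLog P (powMatrix P θ) r v w ≤ Real.log r' := by
  set π := edgeMeasure (powMatrix P θ) r v w with hπ
  have hwv := dotProduct_pos_of_pos h.right_pos h.left_pos
  set g : S → ℝ := fun i => Real.log (v' i) - Real.log (v i)
  -- With the stochastic kernels `q i j = A(θ) i j * v j / (v i * r)` and its primed analogue `q'`,
  -- the bracket is `log (q' / q)` on possible edges. This is nonnegativity of relative entropy,
  -- termwise through `log x ≤ x - 1`; the right side sums to zero.
  have hpt : ∀ i j, π i j * ((θ' - θ) * Real.log (P i j) + (g j - g i) + (Real.log r - Real.log r'))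
      ≤ w i * v i / (w ⬝ᵥ v) *
        (powMatrix P θ' i j * v' j / (v' i * r') - powMatrix P θ i j * v j / (v i * r)) := by
    intro i j
    rcases (hP i j).eq_or_lt with h0 | h0
    · simp [hπ, edgeMeasure, powMatrix_of_eq_zero h0.symm]
    · have hr := h.pos
      have hr' := h'.pos
      have hvi := h.right_pos i
      have hvj := h.right_pos j
      have hvi' := h'.right_pos i
      have hvj' := h'.right_pos j
      have hwi := h.left_pos i
      have hq : 0 < powMatrix P θ i j * v j / (v i * r) := by
        have := powMatrix_pos h0 θ
        positivity
      have hq' : 0 < powMatrix P θ' i j * v' j / (v' i * r') := by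
        have := powMatrix_pos h0 θ'
        positivity
      set q := powMatrix P θ i j * v j / (v i * r) with hqdef
      set q' := powMatrix P θ' i j * v' j / (v' i * r') with hqdef'
      have hπq : π i j = w i * v i / (w ⬝ᵥ v) * q := by
        rw [hπ, edgeMeasure, hqdef]
        field_simp
      have hlogq : Real.log q =
          θ * Real.log (P i j) + Real.log (v j) - (Real.log (v i) + Real.log r) := by
        have := powMatrix_pos h0 θ
        rw [hqdef, Real.log_div (by positivity) (by positivity), Real.log_mul this.ne' hvj.ne',
          Real.log_mul hvi.ne' hr.ne', powMatrix_of_pos h0, Real.log_rpow h0]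
      have hlogq' : Real.log q' =
          θ' * Real.log (P i j) + Real.log (v' j) - (Real.log (v' i) + Real.log r') := by
        have := powMatrix_pos h0 θ'
        rw [hqdef', Real.log_div (by positivity) (by positivity), Real.log_mul this.ne' hvj'.ne',
          Real.log_mul hvi'.ne' hr'.ne', powMatrix_of_pos h0, Real.log_rpow h0]
      have hlog : (θ' - θ) * Real.log (P i j) + (g j - g i) + (Real.log r - Real.log r')
          = Real.log (q' / q) := by
        rw [Real.log_div hq'.ne' hq.ne', hlogq, hlogq']
        ring
      rw [hlog, hπq, mul_assoc]
      refine mul_le_mul_of_nonneg_left ?_ (by positivity)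
      calc q * Real.log (q' / q) ≤ q * (q' / q - 1) :=
            mul_le_mul_of_nonneg_left (Real.log_le_sub_one_of_pos (by positivity)) hq.le
        _ = q' - q := by field_simp
  have hsum := Finset.sum_le_sum fun i (_ : i ∈ Finset.univ) =>
    Finset.sum_le_sum fun j (_ : j ∈ Finset.univ) => hpt i j
  have hrow : ∀ {t s : ℝ} {x y : S → ℝ}, IsPerron (powMatrix P t) s x y → ∀ i,
      ∑ j, powMatrix P t i j * x j / (x i * s) = 1 := by
    intro t s x y hx i
    have h1 : ∑ j, powMatrix P t i j * x j = s * x i := congrFun hx.right_eq i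
    rw [← Finset.sum_div, h1, mul_comm]
    exact div_self (mul_pos (hx.right_pos i) hx.pos).ne'
  have hright : ∑ i, ∑ j, w i * v i / (w ⬝ᵥ v) *
        (powMatrix P θ' i j * v' j / (v' i * r') - powMatrix P θ i j * v j / (v i * r)) = 0 := by
    simp only [← Finset.mul_sum, Finset.sum_sub_distrib, hrow h, hrow h', sub_self, mul_zero,
      Finset.sum_const_zero]
  rw [hright] at hsum
  have hleft : ∑ i, ∑ j, π i j *
      ((θ' - θ) * Real.log (P i j) + (g j - g i) + (Real.log r - Real.log r'))
      = (θ' - θ) * meanLog P (powMatrix P θ) r v w + 0 + 1 * (Real.log r - Real.log r') := by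
    rw [← sum_edgeMeasure_mul_sub h g, ← sum_edgeMeasure h, meanLog, Finset.mul_sum,
      Finset.sum_mul, ← Finset.sum_add_distrib, ← Finset.sum_add_distrib]
    refine Finset.sum_congr rfl fun i _ => ?_
    rw [Finset.mul_sum, Finset.sum_mul, ← Finset.sum_add_distrib, ← Finset.sum_add_distrib]
    exact Finset.sum_congr rfl fun j _ => by ring
  linarith

lemma meanLog_nonpos (hP : ∀ i j, 0 ≤ P i j) (hP1 : ∀ i j, P i j ≤ 1)
    (h : IsPerron (powMatrix P θ) r v w) : meanLog P (powMatrix P θ) r v w ≤ 0 :=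
  Finset.sum_nonpos fun i _ => Finset.sum_nonpos fun j _ => mul_nonpos_of_nonneg_of_nonpos
    (edgeMeasure_nonneg (powMatrix_nonneg hP θ) h i j) (Real.log_nonpos (hP i j) (hP1 i j))

lemma meanLog_neg (hP : ∀ i j, 0 ≤ P i j) (hP1 : ∀ i j, P i j ≤ 1)
    (hlt : ∃ i j, 0 < P i j ∧ P i j < 1)
    (h : IsPerron (powMatrix P θ) r v w) : meanLog P (powMatrix P θ) r v w < 0 := by
  have hterm : ∀ i j, edgeMeasure (powMatrix P θ) r v w i j * Real.log (P i j) ≤ 0 := fun i j =>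
    mul_nonpos_of_nonneg_of_nonpos
      (edgeMeasure_nonneg (powMatrix_nonneg hP θ) h i j) (Real.log_nonpos (hP i j) (hP1 i j))
  obtain ⟨i, j, h0, h1⟩ := hlt
  have hpos : 0 < edgeMeasure (powMatrix P θ) r v w i j :=
    div_pos (mul_pos (mul_pos (h.left_pos i) (powMatrix_pos h0 θ)) (h.right_pos j))
      (mul_pos h.pos (dotProduct_pos_of_pos h.right_pos h.left_pos))
  refine Finset.sum_neg' (fun i _ => Finset.sum_nonpos fun j _ => hterm i j)
    ⟨i, Finset.mem_univ _, Finset.sum_neg' (fun j _ => hterm i j) ⟨j, Finset.mem_univ _, ?_⟩⟩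
  exact mul_neg_of_pos_of_neg hpos (Real.log_neg h0 h1)

lemma neg_sum_abs_log_le_meanLog (hP : ∀ i j, 0 ≤ P i j)
    (h : IsPerron (powMatrix P θ) r v w) :
    -∑ p : S × S, |Real.log (P p.1 p.2)| ≤ meanLog P (powMatrix P θ) r v w := by
  set c := ∑ p : S × S, |Real.log (P p.1 p.2)|
  calc -c = ∑ i, ∑ j, edgeMeasure (powMatrix P θ) r v w i j * (-c) := by
        simp only [← Finset.sum_mul, sum_edgeMeasure h, one_mul]
    _ ≤ _ := by
        refine Finset.sum_le_sum fun i _ => Finset.sum_le_sum fun j _ =>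
          mul_le_mul_of_nonneg_left ?_ (edgeMeasure_nonneg (powMatrix_nonneg hP θ) h i j)
        have : |Real.log (P i j)| ≤ c := Finset.single_le_sum
          (f := fun p : S × S => |Real.log (P p.1 p.2)|) (fun p _ => abs_nonneg _)
          (Finset.mem_univ (i, j))
        linarith [neg_abs_le (Real.log (P i j))]

end Gibbs

section Family

variable [Nonempty S] {ρ : ℝ → ℝ} {v w : ℝ → S → ℝ}

/-- The tangents at two points squeeze the increment of `log ρ`; their slopes lie in `[-c, 0]`, so
`log ρ` is Lipschitz. -/
theorem continuous_log_perron (hP : ∀ i j, 0 ≤ P i j)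
    (h : ∀ θ, IsPerron (powMatrix P θ) (ρ θ) (v θ) (w θ)) (hP1 : ∀ i j, P i j ≤ 1) :
    Continuous fun θ => Real.log (ρ θ) := by
  set c := ∑ p : S × S, |Real.log (P p.1 p.2)| with hc
  have hc0 : 0 ≤ c := Finset.sum_nonneg fun p _ => abs_nonneg _
  have hanti : ∀ s t, s ≤ t → |Real.log (ρ s) - Real.log (ρ t)| ≤ c * |s - t| := by
    intro s t hst
    have h1 := log_add_mul_meanLog_le hP (h s) (h t)
    have h2 := log_add_mul_meanLog_le hP (h t) (h s)
    have h3 := neg_sum_abs_log_le_meanLog hP (h s)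
    have h4 := meanLog_nonpos hP hP1 (h t)
    have h5 := mul_nonneg (sub_nonneg.2 hst) (neg_le_iff_add_nonneg.1 h3)
    have h6 := mul_nonneg (sub_nonneg.2 hst) (neg_nonneg.2 h4)
    rw [abs_of_nonpos (sub_nonpos.2 hst), abs_le]
    constructor <;> nlinarith
  refine (LipschitzWith.of_dist_le_mul (K := ⟨c, hc0⟩) fun s t => ?_).continuous
  rw [Real.dist_eq, Real.dist_eq]
  rcases le_total s t with hst | hst
  · exact hanti s t hst
  · rw [abs_sub_comm, abs_sub_comm s]
    exact hanti t s hst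

theorem continuous_perron (hP : ∀ i j, 0 ≤ P i j)
    (h : ∀ θ, IsPerron (powMatrix P θ) (ρ θ) (v θ) (w θ)) (hP1 : ∀ i j, P i j ≤ 1) :
    Continuous ρ := by
  have := Real.continuous_exp.comp (continuous_log_perron hP h hP1)
  exact this.congr fun θ => Real.exp_log (h θ).pos

variable [DecidableEq S]

/-- By compactness of the simplex it suffices to identify cluster points; each is a normalised
eigenvector of the limiting matrix, hence `v θ` by `right_unique`. -/
theorem continuous_right (hP : ∀ i j, 0 ≤ P i j) (hprim : ∀ θ, (powMatrix P θ).IsPrimitive)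
    (h : ∀ θ, IsPerron (powMatrix P θ) (ρ θ) (v θ) (w θ)) (hP1 : ∀ i j, P i j ≤ 1) :
    Continuous v := by
  rw [continuous_iff_continuousAt]
  intro θ
  have hmem : ∀ t, v t ∈ stdSimplex ℝ S := fun t =>
    ⟨fun i => ((h t).right_pos i).le, (h t).right_sum⟩
  refine (isCompact_stdSimplex ℝ S).tendsto_nhds_of_unique_mapClusterPt
    (Eventually.of_forall hmem) fun y hy hcl => (h θ).right_unique (hprim θ) ?_ hy.2
  have hv_le : ∀ t j, |v t j| ≤ 1 := fun t j => by
    rw [abs_of_pos ((h t).right_pos j)]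
    exact (h t).right_sum ▸ Finset.single_le_sum (fun i _ => ((h t).right_pos i).le)
      (Finset.mem_univ j)
  have hbdd : ∀ j, IsBoundedUnder (· ≤ ·) (𝓝 θ) (norm ∘ fun t => v t j) := fun j =>
    isBoundedUnder_of ⟨1, fun t => hv_le t j⟩
  have hzero : ∀ i, Tendsto
      (fun t => (powMatrix P θ *ᵥ v t) i - ρ θ * v t i) (𝓝 θ) (𝓝 0) := by
    intro i
    have heq : ∀ t, (powMatrix P θ *ᵥ v t) i - ρ θ * v t i =
        ∑ j, (powMatrix P θ i j - powMatrix P t i j) * v t j - (ρ θ - ρ t) * v t i := by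
      intro t
      have h1 : ∑ j, powMatrix P t i j * v t j = ρ t * v t i := congrFun (h t).right_eq i
      simp only [sub_mul, Finset.sum_sub_distrib, h1, mulVec, dotProduct]
      ring
    simp only [heq]
    have h1 : ∀ j, Tendsto (fun t => (powMatrix P θ i j - powMatrix P t i j) * v t j) (𝓝 θ)
        (𝓝 0) := fun j => by
      have : Tendsto (fun t => powMatrix P θ i j - powMatrix P t i j) (𝓝 θ) (𝓝 0) := by
        have := (hasDerivAt_powMatrix hP θ i j).continuousAt.tendsto.const_sub (powMatrix P θ i j)
        rwa [sub_self] at this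
      exact this.zero_mul_isBoundedUnder_le (hbdd j)
    have h2 : Tendsto (fun t => (ρ θ - ρ t) * v t i) (𝓝 θ) (𝓝 0) := by
      have := ((continuous_perron hP h hP1).tendsto θ).const_sub (ρ θ)
      rw [sub_self] at this
      exact this.zero_mul_isBoundedUnder_le (hbdd i)
    simpa using (tendsto_finsetSum _ fun j _ => h1 j).sub h2
  funext i
  have hcont : Continuous fun x : S → ℝ => (powMatrix P θ *ᵥ x) i - ρ θ * x i := by
    simp only [mulVec, dotProduct]
    fun_prop
  have hcl' : MapClusterPt ((powMatrix P θ *ᵥ y) i - ρ θ * y i) (𝓝 θ)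
      (fun t => (powMatrix P θ *ᵥ v t) i - ρ θ * v t i) :=
    hcl.continuousAt_comp (f := fun x : S → ℝ => (powMatrix P θ *ᵥ x) i - ρ θ * x i)
      hcont.continuousAt
  have : (powMatrix P θ *ᵥ y) i - ρ θ * y i = 0 := by
    have hc : ClusterPt ((powMatrix P θ *ᵥ y) i - ρ θ * y i) (𝓝 (0 : ℝ)) :=
      ClusterPt.mono hcl' (hzero i)
    exact eq_of_nhds_neBot hc
  simpa [sub_eq_zero] using this

/-- Pairing the eigenvector equation at `t` with the fixed left vector `w θ` gives `(ρ t - ρ θ) (w θ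
· v t) = w θ (A t - A θ) v t`, so continuity of `v` is enough. -/
theorem differentiable_perron (hP : ∀ i j, 0 ≤ P i j) (hprim : ∀ θ, (powMatrix P θ).IsPrimitive)
    (h : ∀ θ, IsPerron (powMatrix P θ) (ρ θ) (v θ) (w θ)) (hP1 : ∀ i j, P i j ≤ 1) :
    Differentiable ℝ ρ := by
  intro θ
  have hv := (continuous_right hP hprim h hP1).tendsto θ
  have hvj : ∀ j, Tendsto (fun t => v t j) (𝓝[≠] θ) (𝓝 (v θ j)) := fun j =>
    ((continuous_apply j).tendsto _).comp (hv.mono_left nhdsWithin_le_nhds)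
  have hslope : ∀ t, t ≠ θ → slope ρ θ t =
      (∑ i, ∑ j, w θ i * slope (fun t => powMatrix P t i j) θ t * v t j) / ∑ i, w θ i * v t i := by
    intro t ht
    have hpos : 0 < ∑ i, w θ i * v t i := dotProduct_pos_of_pos (h t).right_pos (h θ).left_pos
    rw [eq_div_iff hpos.ne']
    have h1 : ∀ i, ∑ j, powMatrix P t i j * v t j = ρ t * v t i := congrFun (h t).right_eq
    have h2 : ∀ j, ∑ i, w θ i * powMatrix P θ i j = ρ θ * w θ j := congrFun (h θ).left_eq
    have h3 : ∑ i, ∑ j, w θ i * powMatrix P t i j * v t j = ρ t * ∑ i, w θ i * v t i := by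
      simp only [mul_assoc, ← Finset.mul_sum, h1]
      rw [Finset.mul_sum]
      exact Finset.sum_congr rfl fun i _ => by ring
    have h4 : ∑ i, ∑ j, w θ i * powMatrix P θ i j * v t j = ρ θ * ∑ i, w θ i * v t i := by
      rw [Finset.sum_comm]
      simp only [← Finset.sum_mul, h2]
      rw [Finset.mul_sum]
      exact Finset.sum_congr rfl fun i _ => by ring
    calc slope ρ θ t * ∑ i, w θ i * v t i
        = (t - θ)⁻¹ * (ρ t * ∑ i, w θ i * v t i - ρ θ * ∑ i, w θ i * v t i) := by
          rw [slope_def_field]; ring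
      _ = _ := by
          rw [← h3, ← h4, ← Finset.sum_sub_distrib, Finset.mul_sum]
          refine Finset.sum_congr rfl fun i _ => ?_
          rw [← Finset.sum_sub_distrib, Finset.mul_sum]
          refine Finset.sum_congr rfl fun j _ => ?_
          rw [slope_def_field]
          ring
  have hlim : Tendsto (slope ρ θ) (𝓝[≠] θ)
      (𝓝 ((∑ i, ∑ j, w θ i * (powMatrix P θ i j * Real.log (P i j)) * v θ j)
        / ∑ i, w θ i * v θ i)) := by
    have h1 : Tendsto (fun t => (∑ i, ∑ j, w θ i * slope (fun t => powMatrix P t i j) θ t * v t j)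
        / ∑ i, w θ i * v t i) (𝓝[≠] θ)
        (𝓝 ((∑ i, ∑ j, w θ i * (powMatrix P θ i j * Real.log (P i j)) * v θ j)
        / ∑ i, w θ i * v θ i)) := by
      refine Tendsto.div (tendsto_finsetSum _ fun i _ => tendsto_finsetSum _ fun j _ => ?_)
        (tendsto_finsetSum _ fun i _ => (hvj i).const_mul _)
        (dotProduct_pos_of_pos (h θ).right_pos (h θ).left_pos).ne'
      exact ((hasDerivAt_iff_tendsto_slope.1 (hasDerivAt_powMatrix hP θ i j)).const_mul _).mul
        (hvj j)
    refine h1.congr' ?_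
    filter_upwards [self_mem_nhdsWithin] with t ht using (hslope t ht).symm
  exact (hasDerivAt_iff_tendsto_slope.2 hlim).differentiableAt

theorem deriv_perron (hP : ∀ i j, 0 ≤ P i j) (hprim : ∀ θ, (powMatrix P θ).IsPrimitive)
    (h : ∀ θ, IsPerron (powMatrix P θ) (ρ θ) (v θ) (w θ)) (hP1 : ∀ i j, P i j ≤ 1) (θ : ℝ) :
    deriv ρ θ = ρ θ * meanLog P (powMatrix P θ) (ρ θ) (v θ) (w θ) := by
  set L := meanLog P (powMatrix P θ) (ρ θ) (v θ) (w θ)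
  have hd : HasDerivAt (fun t => Real.log (ρ t) - (t - θ) * L) (deriv ρ θ / ρ θ - 1 * L) θ :=
    ((differentiable_perron hP hprim h hP1 θ).hasDerivAt.log (h θ).pos.ne').sub
      (((hasDerivAt_id θ).sub_const θ).mul_const L)
  -- The tangent inequality identifies the slope: `log ρ` minus its tangent line is minimal at `θ`.
  have hmin : IsLocalMin (fun t => Real.log (ρ t) - (t - θ) * L) θ := by
    refine Eventually.of_forall fun t => ?_
    have := log_add_mul_meanLog_le hP (h θ) (h t)
    simp only [sub_self, zero_mul, sub_zero]
    linarith
  have h0 := hmin.hasDerivAt_eq_zero hd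
  have h1 := (h θ).pos.ne'
  field_simp at h0
  linarith

end Family

end MarkovTrie

/-! ### The asymptotic slope of the logarithm of the eigenvalue. -/

namespace MarkovTrie

open Matrix

variable {S : Type*} [Fintype S] [DecidableEq S] {P : Matrix S S ℝ}

lemma powMatrix_isPrimitive (hprim : P.IsPrimitive) (θ : ℝ) : (powMatrix P θ).IsPrimitive := by
  obtain ⟨k, hk, hpos⟩ := hprim.exists_pos_pow
  exact ⟨powMatrix_nonneg hprim.nonneg θ, k, hk, fun i j => pow_apply_pos_of_pos hprim.nonneg
    (powMatrix_nonneg hprim.nonneg θ) (fun _ _ h => powMatrix_pos h θ) k (hpos i j)⟩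

/-- Otherwise the chain is a deterministic map, and every power of `P` has a single nonzero entry
per row, which contradicts primitivity. -/
lemma exists_pos_lt_one [Nontrivial S] (hP : P ∈ rowStochastic ℝ S) (hprim : P.IsPrimitive) :
    ∃ i j, 0 < P i j ∧ P i j < 1 := by
  by_contra! hne
  have h01 : ∀ i j, P i j ≠ 0 → P i j = 1 := fun i j h =>
    (le_one_of_mem_rowStochastic hP).antisymm (hne i j ((hprim.nonneg i j).lt_of_ne' h))
  have hex : ∀ i, ∃ j, P i j ≠ 0 := by
    intro i
    by_contra! h
    have := sum_row_of_mem_rowStochastic hP i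
    simp [h] at this
  choose f hf using hex
  have hPf : ∀ i j, P i j = if f i = j then 1 else 0 := by
    intro i j
    split_ifs with hij
    · exact hij ▸ h01 _ _ (hf i)
    · by_contra h
      have h1 := Finset.add_le_sum (s := Finset.univ) (f := fun j => P i j)
        (fun j _ => hprim.nonneg i j) (Finset.mem_univ (f i)) (Finset.mem_univ j) hij
      rw [sum_row_of_mem_rowStochastic hP i, h01 _ _ (hf i), h01 _ _ h] at h1
      norm_num at h1
  have hpow : ∀ n i j, (P ^ n) i j = if f^[n] i = j then 1 else 0 := by
    intro n
    induction n with
    | zero => intro i j; rw [pow_zero, one_apply]; rfl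
    | succ n ih =>
      intro i j
      rw [pow_succ', mul_apply, Finset.sum_eq_single (f i), hPf, if_pos rfl, one_mul, ih]
      · rfl
      · intro x _ hx
        rw [hPf, if_neg hx.symm, zero_mul]
      · simp
  obtain ⟨k, -, hpos⟩ := hprim.exists_pos_pow
  obtain ⟨a, b, hab⟩ := exists_pair_ne S
  have ha := hpos a a
  have hb := hpos a b
  rw [hpow] at ha hb
  have ha' : f^[k] a = a := by by_contra h; simp [h] at ha
  have hb' : f^[k] a = b := by by_contra h; simp [h] at hb
  exact hab (ha'.symm.trans hb')

/-- The Perron eigenvalues `ρ θ` of `powMatrix P θ` together with the asymptotic slope `l` of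
`s ↦ log (ρ (-s))`. -/
theorem exists_asymptotic_slope [Nontrivial S] (hP : P ∈ rowStochastic ℝ S)
    (hprim : P.IsPrimitive) : ∃ (ρ : ℝ → ℝ) (v w : ℝ → S → ℝ) (l : ℝ),
      (∀ θ, IsPerron (powMatrix P θ) (ρ θ) (v θ) (w θ)) ∧ Differentiable ℝ ρ ∧ 0 < l ∧
      Tendsto (fun θ => ρ θ / (-deriv ρ θ)) atBot (𝓝 l⁻¹) ∧ 1 < ρ 0 ∧
      ∀ ε > 0, ∃ s > 0, Real.log (ρ (-s)) ≤ s * (l + ε) ∧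
        s * (l - ε) ≤ Real.log (ρ (-s)) - Real.log (Fintype.card S) := by
  have hprim' := powMatrix_isPrimitive hprim
  choose ρ v w h using fun θ => (hprim' θ).exists_isPerron
  have hP0 := hprim.nonneg
  have hP1 : ∀ i j, P i j ≤ 1 := fun i j => le_one_of_mem_rowStochastic hP
  set Λ : ℝ → ℝ := fun θ => -meanLog P (powMatrix P θ) (ρ θ) (v θ) (w θ) with hΛ
  have htan : ∀ θ θ', Real.log (ρ θ) - (θ' - θ) * Λ θ ≤ Real.log (ρ θ') := fun θ θ' => by
    have := log_add_mul_meanLog_le hP0 (h θ) (h θ')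
    simp only [hΛ]
    linarith
  have hΛpos : ∀ θ, 0 < Λ θ := fun θ =>
    neg_pos.2 (meanLog_neg hP0 hP1 (exists_pos_lt_one hP hprim) (h θ))
  have hbdd : BddAbove (Set.range Λ) := by
    refine ⟨∑ p : S × S, |Real.log (P p.1 p.2)|, ?_⟩
    rintro _ ⟨θ, rfl⟩
    exact neg_le.1 (neg_sum_abs_log_le_meanLog hP0 (h θ))
  have hanti : Antitone Λ := by
    intro a b hab
    rcases hab.eq_or_lt with rfl | hab
    · exact le_rfl
    · have h1 := htan a b
      have h2 := htan b a
      by_contra! hlt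
      nlinarith
  set l := ⨆ θ, Λ θ
  have hle : ∀ θ, Λ θ ≤ l := fun θ => le_ciSup hbdd θ
  have hl : 0 < l := (hΛpos 0).trans_le (hle 0)
  have hlim : Tendsto Λ atBot (𝓝 l) := tendsto_atBot_ciSup hanti hbdd
  refine ⟨ρ, v, w, l, h, differentiable_perron hP0 hprim' h hP1, hl, ?_, ?_, fun ε hε => ?_⟩
  · refine (hlim.inv₀ hl.ne').congr fun θ => ?_
    rw [deriv_perron hP0 hprim' h hP1, neg_mul_eq_mul_neg]
    change (Λ θ)⁻¹ = ρ θ / (ρ θ * Λ θ)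
    have h1 := (h θ).pos.ne'
    have h2 := (hΛpos θ).ne'
    field_simp
  -- `A(1) = P` is stochastic, and the tangent at `1` has negative slope, hence `ρ 0 > 1`.
  · have hρ1 : ρ 1 = 1 := by
      have h1 : ∀ j, ∑ i, w 1 i * P i j = ρ 1 * w 1 j := fun j => by
        have := congrFun (h 1).left_eq j
        simpa [vecMul, dotProduct, powMatrix_one] using this
      have h2 : ∑ j, ∑ i, w 1 i * P i j = ∑ i, w 1 i := by
        rw [Finset.sum_comm]
        simp [← Finset.mul_sum, sum_row_of_mem_rowStochastic hP]
      simp only [h1, ← Finset.mul_sum] at h2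
      have hpos : 0 < ∑ i, w 1 i := Finset.sum_pos (fun i _ => (h 1).left_pos i)
        Finset.univ_nonempty
      exact mul_right_cancel₀ hpos.ne' (h2.trans (one_mul _).symm)
    have h1 := htan 1 0
    rw [hρ1, Real.log_one] at h1
    exact (Real.log_pos_iff (h 0).pos.le).1 (by linarith [hΛpos 1])
  · obtain ⟨t, ht⟩ := (hlim.eventually (lt_mem_nhds (show l - ε / 2 < l by linarith))).exists
    set B := Real.log (Fintype.card S) - Real.log (ρ t) - t * Λ t
    set s := max 1 (max (Real.log (ρ 0) / ε) (2 * B / ε))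
    have hs1 : 1 ≤ s := le_max_left _ _
    have hs2 : Real.log (ρ 0) / ε ≤ s := (le_max_left _ _).trans (le_max_right _ _)
    have hs3 : 2 * B / ε ≤ s := (le_max_right _ _).trans (le_max_right _ _)
    rw [div_le_iff₀ hε] at hs2 hs3
    have hs0 : 0 < s := by linarith
    refine ⟨s, hs0, ?_, ?_⟩
    · have h1 := htan (-s) 0
      have h2 := mul_le_mul_of_nonneg_left (hle (-s)) hs0.le
      linarith
    · have h1 := htan t (-s)
      have h2 := mul_le_mul_of_nonneg_left ht.le hs0.le
      simp only [B] at hs3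
      linarith

/-! ### Extremal box sizes and the number of possible boxes. -/

section Boxes

omit [DecidableEq S] [Fintype S]

lemma boxSize_zero (P : Matrix S S ℝ) (i : S) (u : Fin 0 → S) : boxSize P i u = 1 := by
  simp [boxSize]

lemma boxSize_cons (P : Matrix S S ℝ) (i j : S) {n : ℕ} (u : Fin n → S) :
    boxSize P i (Fin.cons j u : Fin (n + 1) → S) = P i j * boxSize P j u := by
  rw [boxSize, Fin.prod_univ_succ]
  rfl

lemma boxSize_nonneg (hP : ∀ i j, 0 ≤ P i j) (i : S) {n : ℕ} (u : Fin n → S) :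
    0 ≤ boxSize P i u := Finset.prod_nonneg fun _ _ => hP _ _

lemma boxSize_snoc (P : Matrix S S ℝ) (i j : S) {n : ℕ} (u : Fin n → S) :
    boxSize P i (Fin.snoc u j : Fin (n + 1) → S) =
      boxSize P i u * P ((Fin.cons i u : Fin (n + 1) → S) (Fin.last n)) j := by
  have key : ∀ k : Fin (n + 1), (Fin.cons i (Fin.snoc u j : Fin (n + 1) → S) : Fin (n + 2) → S)
      k.castSucc = (Fin.cons i u : Fin (n + 1) → S) k := by
    intro k
    refine Fin.cases rfl (fun k => ?_) k
    rw [← Fin.succ_castSucc, Fin.cons_succ, Fin.cons_succ, Fin.snoc_castSucc]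
  simp only [boxSize, key, Fin.prod_univ_castSucc, Fin.snoc_castSucc, Fin.snoc_last]

end Boxes

section Estimates

variable {s r : ℝ} {v w : S → ℝ}

omit [DecidableEq S]

lemma _root_.Matrix.IsPerron.right_le_one {A : Matrix S S ℝ} (h : IsPerron A r v w) (i : S) :
    v i ≤ 1 :=
  h.right_sum ▸ Finset.single_le_sum (fun i _ => (h.right_pos i).le) (Finset.mem_univ i)

/-- Along a path, each single term `A i j * v j` is at most the whole sum `r * v i`; iterate, then
take the power `-1/s`. -/
theorem exists_le_boxSize [Nonempty S] (hP : ∀ i j, 0 ≤ P i j) {Λ : ℝ} (hs : 0 < s)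
    (h : IsPerron (powMatrix P (-s)) r v w) (hr : Real.log r ≤ s * Λ) :
    ∃ c > 0, ∀ (n : ℕ) (i : S) (u : Fin n → S), 0 < boxSize P i u →
      c * Real.exp (-(n * Λ)) ≤ boxSize P i u := by
  obtain ⟨i₁, hi₁⟩ := Finite.exists_min v
  have hm := h.right_pos i₁
  have key : ∀ (n : ℕ) (i : S) (u : Fin n → S), 0 < boxSize P i u →
      boxSize P i u ^ (-s) * v i₁ ≤ r ^ n * v i := by
    intro n
    induction n with
    | zero => intro i u _; simpa [boxSize_zero] using hi₁ i
    | succ n ih =>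
      intro i u hu
      obtain ⟨j, u, rfl⟩ : ∃ j u', u = Fin.cons j u' := ⟨u 0, Fin.tail u, (Fin.cons_self_tail u).symm⟩
      rw [boxSize_cons] at hu ⊢
      have h1 := pos_of_mul_pos_left hu (boxSize_nonneg hP j u)
      have h2 := pos_of_mul_pos_right hu (hP i j)
      have hA := powMatrix_pos h1 (-s)
      have hsum : powMatrix P (-s) i j * v j ≤ r * v i := by
        have h3 : ∑ j, powMatrix P (-s) i j * v j = r * v i := congrFun h.right_eq i
        exact h3 ▸ Finset.single_le_sum (f := fun j => powMatrix P (-s) i j * v j)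
          (fun j _ => mul_nonneg (powMatrix_nonneg hP _ i j) (h.right_pos j).le) (Finset.mem_univ j)
      rw [Real.mul_rpow h1.le h2.le, ← powMatrix_of_pos h1]
      calc powMatrix P (-s) i j * boxSize P j u ^ (-s) * v i₁
          = powMatrix P (-s) i j * (boxSize P j u ^ (-s) * v i₁) := by ring
        _ ≤ powMatrix P (-s) i j * (r ^ n * v j) := mul_le_mul_of_nonneg_left (ih j u h2) hA.le
        _ = r ^ n * (powMatrix P (-s) i j * v j) := by ring
        _ ≤ r ^ n * (r * v i) := mul_le_mul_of_nonneg_left hsum (pow_pos h.pos n).le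
        _ = r ^ (n + 1) * v i := by ring
  refine ⟨Real.exp (Real.log (v i₁) / s), Real.exp_pos _, fun n i u hu => ?_⟩
  have h1 : boxSize P i u ^ (-s) * v i₁ ≤ r ^ n := (key n i u hu).trans
    (mul_le_of_le_one_right (pow_pos h.pos n).le (h.right_le_one i))
  have h2 := Real.log_le_log (mul_pos (Real.rpow_pos_of_pos hu _) hm) h1
  rw [Real.log_mul (Real.rpow_pos_of_pos hu _).ne' hm.ne', Real.log_rpow hu, Real.log_pow] at h2
  rw [← Real.exp_add, ← Real.le_log_iff_exp_le hu]
  have h3 : (n : ℝ) * Real.log r ≤ n * (s * Λ) := mul_le_mul_of_nonneg_left hr n.cast_nonneg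
  have h4 : Real.log (v i₁) ≤ (Real.log (boxSize P i u) + n * Λ) * s := by linarith
  have h5 := (div_le_iff₀ hs).2 h4
  linarith

/-- Greedy construction: at each step some `j` contributes at least the average `r * v i / K`. The
loss `K ^ n` is the `log (Fintype.card S)` in `hr`. -/
theorem exists_boxSize_le [Nonempty S] (hP : ∀ i j, 0 ≤ P i j) {Λ : ℝ} (hs : 0 < s)
    (h : IsPerron (powMatrix P (-s)) r v w)
    (hr : s * Λ ≤ Real.log r - Real.log (Fintype.card S)) :
    ∃ c > 0, ∀ (n : ℕ) (i : S), ∃ u : Fin n → S, 0 < boxSize P i u ∧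
      boxSize P i u ≤ c * Real.exp (-(n * Λ)) := by
  obtain ⟨i₁, hi₁⟩ := Finite.exists_min v
  have hm := h.right_pos i₁
  set K : ℝ := (Fintype.card S : ℝ) with hK
  have hK0 : 0 < K := by simp [hK, Fintype.card_pos]
  have key : ∀ (n : ℕ) (i : S), ∃ u : Fin n → S, 0 < boxSize P i u ∧
      r ^ n * v i ≤ K ^ n * boxSize P i u ^ (-s) := by
    intro n
    induction n with
    | zero => intro i; exact ⟨Fin.elim0, by simp [boxSize_zero], by
        simpa [boxSize_zero] using h.right_le_one i⟩
    | succ n ih =>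
      intro i
      have h3 : ∑ j, powMatrix P (-s) i j * v j = r * v i := congrFun h.right_eq i
      obtain ⟨j, hj⟩ : ∃ j, r * v i ≤ K * (powMatrix P (-s) i j * v j) := by
        by_contra! hlt
        have := Finset.sum_lt_sum_of_nonempty Finset.univ_nonempty fun j (_ : j ∈ Finset.univ) =>
          hlt j
        rw [← Finset.mul_sum, h3] at this
        simp [hK] at this
      have hPij : 0 < P i j := by
        refine (hP i j).lt_of_ne' fun h0 => ?_
        rw [powMatrix_of_eq_zero h0, zero_mul, mul_zero] at hj
        exact absurd hj (not_le.2 (mul_pos h.pos (h.right_pos i)))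
      obtain ⟨u, hu, hle⟩ := ih j
      refine ⟨Fin.cons j u, ?_, ?_⟩
      · rw [boxSize_cons]; exact mul_pos hPij hu
      · rw [boxSize_cons, Real.mul_rpow hPij.le hu.le, ← powMatrix_of_pos hPij]
        have hA := powMatrix_pos hPij (-s)
        calc r ^ (n + 1) * v i = r ^ n * (r * v i) := by ring
          _ ≤ r ^ n * (K * (powMatrix P (-s) i j * v j)) :=
              mul_le_mul_of_nonneg_left hj (pow_pos h.pos n).le
          _ = K * powMatrix P (-s) i j * (r ^ n * v j) := by ring
          _ ≤ K * powMatrix P (-s) i j * (K ^ n * boxSize P j u ^ (-s)) :=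
              mul_le_mul_of_nonneg_left hle (by positivity)
          _ = _ := by ring
  refine ⟨Real.exp (-(Real.log (v i₁) / s)), Real.exp_pos _, fun n i => ?_⟩
  obtain ⟨u, hu, hle⟩ := key n i
  refine ⟨u, hu, ?_⟩
  have h1 : r ^ n * v i₁ ≤ K ^ n * boxSize P i u ^ (-s) :=
    (mul_le_mul_of_nonneg_left (hi₁ i) (pow_pos h.pos n).le).trans hle
  have h2 := Real.log_le_log (mul_pos (pow_pos h.pos n) hm) h1
  rw [Real.log_mul (pow_pos h.pos n).ne' hm.ne', Real.log_mul (pow_pos hK0 n).ne'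
    (Real.rpow_pos_of_pos hu _).ne', Real.log_rpow hu, Real.log_pow, Real.log_pow] at h2
  rw [← Real.exp_add, ← Real.log_le_iff_le_exp hu]
  have h3 : (n : ℝ) * (s * Λ) ≤ n * (Real.log r - Real.log K) :=
    mul_le_mul_of_nonneg_left hr n.cast_nonneg
  have h4 : Real.log (v i₁) ≤ (-Real.log (boxSize P i u) - n * Λ) * s := by linarith
  have h5 := (div_le_iff₀ hs).2 h4
  linarith

open Classical in
theorem pow_mul_le_card_boxes [Nonempty S] (hP : ∀ i j, 0 ≤ P i j)
    (h : IsPerron (powMatrix P 0) r v w) (n : ℕ) (i : S) :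
    r ^ n * v i ≤ ∑ u : Fin n → S, if 0 < boxSize P i u then (1 : ℝ) else 0 := by
  induction n generalizing i with
  | zero => simpa [boxSize_zero] using h.right_le_one i
  | succ n ih =>
    have h3 : ∑ j, powMatrix P 0 i j * v j = r * v i := congrFun h.right_eq i
    rw [← (Fin.consEquiv fun _ : Fin (n + 1) => S).sum_comp, Fintype.sum_prod_type, pow_succ,
      mul_assoc, ← h3, Finset.mul_sum]
    refine Finset.sum_le_sum fun j _ => ?_
    change _ ≤ ∑ u : Fin n → S,
      if 0 < boxSize P i (Fin.cons j u : Fin (n + 1) → S) then (1 : ℝ) else 0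
    simp only [boxSize_cons]
    rcases (hP i j).eq_or_lt with h0 | h0
    · simp [← h0, powMatrix_of_eq_zero h0.symm]
    · simp only [powMatrix_of_pos h0, Real.rpow_zero, one_mul, mul_pos_iff_of_pos_left h0]
      exact ih j

end Estimates

/-! ### Existence and monotonicity of deficient boxes. -/

section Saturation

variable {Ω : Type*} {i₀ : S} {Y : ℕ → ℕ → Ω → S} {m m' j n n' : ℕ} {ω : Ω}

omit [DecidableEq S]

/-- The number of possible boxes grows without bound since `r > 1`, whereas `m` balls occupy at most
`m` boxes of a generation. -/
theorem exists_hasDeficientBox [Nonempty S] {r : ℝ} {v w : S → ℝ} (hP : ∀ i j, 0 ≤ P i j)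
    (h : IsPerron (powMatrix P 0) r v w) (hr : 1 < r) (hj : 1 ≤ j) :
    ∃ n, HasDeficientBox P i₀ Y m j n ω := by
  classical
  obtain ⟨n, hn⟩ := pow_unbounded_of_one_lt (m / v i₀) hr
  rw [div_lt_iff₀ (h.right_pos i₀)] at hn
  refine ⟨n, ?_⟩
  by_contra hdef
  simp only [HasDeficientBox, not_exists, not_and, not_lt] at hdef
  have hcard := pow_mul_le_card_boxes hP h n i₀
  rw [Finset.sum_boole] at hcard
  have hsub : (Finset.univ.filter fun u : Fin n → S => 0 < boxSize P i₀ u) ⊆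
      (Finset.range m).image fun b (k : Fin n) => Y b (k + 1) ω := by
    intro u hu
    have h1 := hj.trans (hdef u (Finset.mem_filter.1 hu).2)
    rw [Nat.succ_le_iff, ballCount, Finset.card_pos] at h1
    obtain ⟨b, hb⟩ := h1
    simp only [Finset.mem_filter] at hb
    exact Finset.mem_image.2 ⟨b, hb.1, funext hb.2⟩
  have h1 := (Finset.card_le_card hsub).trans Finset.card_image_le
  rw [Finset.card_range] at h1
  have h2 : ((Finset.univ.filter fun u : Fin n → S => 0 < boxSize P i₀ u).card : ℝ) ≤ m := by
    exact_mod_cast h1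
  linarith

omit [Fintype S] in
lemma HasDeficientBox.anti_balls (h : HasDeficientBox P i₀ Y m' j n ω) (hm : m ≤ m') :
    HasDeficientBox P i₀ Y m j n ω := by
  obtain ⟨u, hu, hc⟩ := h
  refine ⟨u, hu, lt_of_le_of_lt ?_ hc⟩
  refine Finset.card_le_card fun b hb => ?_
  simp only [Finset.mem_filter, Finset.mem_range] at hb ⊢
  exact ⟨hb.1.trans_le hm, hb.2⟩

/-- A possible box has a possible child, as rows sum to `1`, and the child holds no more balls. -/
lemma HasDeficientBox.mono_generation [DecidableEq S] (hP : P ∈ rowStochastic ℝ S)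
    (h : HasDeficientBox P i₀ Y m j n ω) (hn : n ≤ n') : HasDeficientBox P i₀ Y m j n' ω := by
  induction n', hn using Nat.le_induction with
  | base => exact h
  | succ n' _ ih =>
    obtain ⟨u, hu, hc⟩ := ih
    set i := (Fin.cons i₀ u : Fin (n' + 1) → S) (Fin.last n')
    obtain ⟨k, hk⟩ : ∃ k, 0 < P i k := by
      by_contra! hle
      have := Finset.sum_nonpos fun k (_ : k ∈ Finset.univ) => hle k
      rw [sum_row_of_mem_rowStochastic hP] at this
      linarith
    refine ⟨Fin.snoc u k, ?_, lt_of_le_of_lt (Finset.card_le_card ?_) hc⟩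
    · rw [boxSize_snoc]
      exact mul_pos hu hk
    · intro b hb
      simp only [Finset.mem_filter] at hb ⊢
      exact ⟨hb.1, fun l => by simpa using hb.2 l.castSucc⟩

omit [Fintype S] in
lemma saturationLevel_le (h : HasDeficientBox P i₀ Y m j n ω) :
    saturationLevel P i₀ Y m j ω ≤ n := Nat.sInf_le h

lemma lt_saturationLevel [DecidableEq S] (hP : P ∈ rowStochastic ℝ S)
    (hex : ∃ n, HasDeficientBox P i₀ Y m j n ω) (h : ¬ HasDeficientBox P i₀ Y m j n ω) :
    n < saturationLevel P i₀ Y m j ω := by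
  by_contra! hle
  -- Existence is essential here, because `sInf ∅ = 0`.
  have hmem : HasDeficientBox P i₀ Y m j (saturationLevel P i₀ Y m j ω) ω := Nat.sInf_mem hex
  exact h (hmem.mono_generation hP hle)

end Saturation

end MarkovTrie

/-! ### Probability bounds and Borel–Cantelli. -/

namespace MarkovTrie

open Matrix

section Events

variable {S Ω : Type*} {P : Matrix S S ℝ} {i₀ : S} [MeasurableSpace Ω]
  {μ : Measure Ω} {Y : ℕ → ℕ → Ω → S}

/-- The event that ball `b` lies in the box indexed by `u`. -/
def boxEvent (Y : ℕ → ℕ → Ω → S) (b : ℕ) {n : ℕ} (u : Fin n → S) : Set Ω :=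
  {ω | ∀ k : Fin n, Y b (k + 1) ω = u k}

variable [MeasurableSpace S] [MeasurableSingletonClass S]

lemma measurableSet_cylinder {n : ℕ} (u : Fin n → S) :
    MeasurableSet {x : ℕ → S | ∀ k : Fin n, x (k + 1) = u k} := by
  simp only [Set.ofPred_forall]
  exact MeasurableSet.iInter fun k =>
    (measurable_pi_apply ((k : ℕ) + 1) : Measurable fun x : ℕ → S => x (k + 1))
      (measurableSet_singleton (u k))

variable [DecidableEq S]

lemma measurableSet_boxEvent {b : ℕ} (hY : IsMarkovChain (Y b) P i₀ μ) {n : ℕ} (u : Fin n → S) :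
    MeasurableSet (boxEvent Y b u) :=
  (measurable_pi_iff.2 hY.measurable : Measurable fun ω k => Y b k ω) (measurableSet_cylinder u)

variable [IsProbabilityMeasure μ]

lemma measure_boxEvent {b : ℕ} (hY : IsMarkovChain (Y b) P i₀ μ) {n : ℕ} (u : Fin n → S) :
    μ (boxEvent Y b u) = ENNReal.ofReal (boxSize P i₀ u) := by
  have hstart : ∀ᵐ ω ∂μ, Y b 0 ω = i₀ := by
    have h1 := hY.law (fun _ => i₀) 0
    simp only [Nat.le_zero, forall_eq, if_true, Finset.range_zero, Finset.prod_empty,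
      ENNReal.ofReal_one] at h1
    exact (mem_ae_iff_prob_eq_one (hY.measurable 0 (measurableSet_singleton i₀))).2 h1
  -- The word with `i₀` prepended; the default value after time `n` plays no role. `law` also
  -- constrains time `0`, which costs nothing by `hstart`.
  set w : ℕ → S := fun k => if h : k < n + 1 then (Fin.cons i₀ u : Fin (n + 1) → S) ⟨k, h⟩ else i₀
    with hw
  have hw_succ : ∀ k : Fin n, w (k + 1) = u k := fun k => by
    have hk : (k : ℕ) + 1 < n + 1 := Nat.succ_lt_succ k.2
    simp only [hw, hk, dif_pos]
    exact Fin.cons_succ (α := fun _ => S) i₀ u k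
  have hw_cast : ∀ k : Fin n, w k = (Fin.cons i₀ u : Fin (n + 1) → S) k.castSucc := fun k => by
    have hk : (k : ℕ) < n + 1 := k.2.trans (Nat.lt_succ_self n)
    simp only [hw, hk, dif_pos]
    rfl
  have hw0 : w 0 = i₀ := by
    simp only [hw, Nat.succ_pos, dif_pos]
    exact Fin.cons_zero (α := fun _ => S) i₀ u
  have hlaw := hY.law w n
  rw [if_pos hw0, Finset.prod_range] at hlaw
  simp only [hw_succ, hw_cast] at hlaw
  rw [boxSize, ← hlaw]
  refine measure_congr (eventuallyEq_set.2 ?_)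
  filter_upwards [hstart] with ω hω
  constructor
  · intro h k hk
    rcases k with _ | k
    · rw [hω, hw0]
    · rw [h ⟨k, hk⟩, ← hw_succ ⟨k, hk⟩]
  · intro h k
    rw [h (k + 1) k.2, hw_succ]

lemma measure_forall_notMem_le (hP : ∀ i j, 0 ≤ P i j)
    (hY : ∀ b, IsMarkovChain (Y b) P i₀ μ)
    (hindep : iIndepFun (fun (b : ℕ) (ω : Ω) (n : ℕ) => Y b n ω) μ) {n : ℕ} (u : Fin n → S)
    (T : Finset ℕ) : μ (⋂ b ∈ T, (boxEvent Y b u)ᶜ) ≤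
      ENNReal.ofReal (Real.exp (-(boxSize P i₀ u * T.card))) := by
  have h1 := hindep.measure_inter_preimage_eq_mul T
    (sets := fun _ => {x : ℕ → S | ∀ k : Fin n, x (k + 1) = u k}ᶜ)
    (fun _ _ => (measurableSet_cylinder u).compl)
  have h2 : ∀ b, μ (boxEvent Y b u)ᶜ ≤ ENNReal.ofReal (Real.exp (-boxSize P i₀ u)) := fun b => by
    rw [prob_compl_eq_one_sub (measurableSet_boxEvent (hY b) u), measure_boxEvent (hY b),
      ← ENNReal.ofReal_one, ← ENNReal.ofReal_sub _ (boxSize_nonneg hP i₀ u)]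
    exact ENNReal.ofReal_le_ofReal (Real.one_sub_le_exp_neg _)
  calc μ (⋂ b ∈ T, (boxEvent Y b u)ᶜ) = ∏ b ∈ T, μ (boxEvent Y b u)ᶜ := h1
    _ ≤ ∏ _b ∈ T, ENNReal.ofReal (Real.exp (-boxSize P i₀ u)) := Finset.prod_le_prod' fun b _ => h2 b
    _ = _ := by
      rw [Finset.prod_const, ← ENNReal.ofReal_pow (Real.exp_pos _).le, ← Real.exp_nat_mul]
      congr 2
      ring

/-- Cut the balls into `j` disjoint blocks of length `m / j`. If every block hit the box, it would
hold `j` balls; so some block misses it. -/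
lemma measure_ballCount_lt_le (hP : ∀ i j, 0 ≤ P i j)
    (hY : ∀ b, IsMarkovChain (Y b) P i₀ μ)
    (hindep : iIndepFun (fun (b : ℕ) (ω : Ω) (n : ℕ) => Y b n ω) μ) {n : ℕ} (u : Fin n → S)
    (m j : ℕ) : μ {ω | ballCount Y m u ω < j} ≤
      j * ENNReal.ofReal (Real.exp (-(boxSize P i₀ u * (m / j : ℕ)))) := by
  set t := m / j with ht
  have hsub : {ω | ballCount Y m u ω < j} ⊆
      ⋃ i ∈ Finset.range j, ⋂ b ∈ Finset.Ico (i * t) ((i + 1) * t), (boxEvent Y b u)ᶜ := by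
    intro ω hω
    by_contra hne
    simp only [Set.mem_iUnion, Set.mem_iInter, not_exists, not_forall, Set.mem_compl_iff,
      not_not, Finset.mem_range, Finset.mem_Ico] at hne
    have hex : ∀ i, ∃ b, i < j → (i * t ≤ b ∧ b < (i + 1) * t) ∧ ω ∈ boxEvent Y b u := fun i => by
      by_cases hi : i < j
      · obtain ⟨b, hb, hbu⟩ := hne i hi
        exact ⟨b, fun _ => ⟨hb, hbu⟩⟩
      · exact ⟨0, fun h => absurd h hi⟩
    choose f hf using hex
    -- Division by the block length recovers the block, so the chosen balls are distinct.
    have hdiv : ∀ i < j, f i / t = i := fun i hi =>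
      Nat.div_eq_of_lt_le (hf i hi).1.1 (hf i hi).1.2
    have hcard : (Finset.range j).card ≤ ballCount Y m u ω := by
      refine Finset.card_le_card_of_injOn f (fun i hi => ?_) fun a ha b hb hab => ?_
      · have hi := Finset.mem_range.1 hi
        have h1 : (i + 1) * t ≤ j * t := Nat.mul_le_mul_right _ hi
        have h2 : j * t ≤ m := Nat.mul_div_le m j
        simp only [Finset.coe_filter, Finset.mem_range]
        exact ⟨(hf i hi).1.2.trans_le (h1.trans h2), (hf i hi).2⟩
      · rw [← hdiv a (Finset.mem_range.1 ha), ← hdiv b (Finset.mem_range.1 hb), hab]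
    rw [Finset.card_range] at hcard
    exact absurd hω (not_lt.2 hcard)
  refine (measure_mono hsub).trans ((measure_biUnion_finset_le _ _).trans ?_)
  calc ∑ i ∈ Finset.range j, μ (⋂ b ∈ Finset.Ico (i * t) ((i + 1) * t), (boxEvent Y b u)ᶜ)
      ≤ ∑ _i ∈ Finset.range j, ENNReal.ofReal (Real.exp (-(boxSize P i₀ u * t))) := by
        refine Finset.sum_le_sum fun i _ => ?_
        have := measure_forall_notMem_le hP hY hindep u (Finset.Ico (i * t) ((i + 1) * t))
        rwa [Nat.card_Ico, show (i + 1) * t - i * t = t by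
          rw [add_mul, one_mul, Nat.add_sub_cancel_left]] at this
    _ = _ := by rw [Finset.sum_const, Finset.card_range, nsmul_eq_mul]

lemma measure_hasDeficientBox_le [Fintype S] (hP : ∀ i j, 0 ≤ P i j)
    (hY : ∀ b, IsMarkovChain (Y b) P i₀ μ)
    (hindep : iIndepFun (fun (b : ℕ) (ω : Ω) (n : ℕ) => Y b n ω) μ) {n : ℕ} {q : ℝ}
    (hq : ∀ u : Fin n → S, 0 < boxSize P i₀ u → q ≤ boxSize P i₀ u) (m j : ℕ) :
    μ {ω | HasDeficientBox P i₀ Y m j n ω} ≤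
      ENNReal.ofReal ((Fintype.card S : ℝ) ^ n * (j * Real.exp (-(q * (m / j : ℕ))))) := by
  have hsub : {ω | HasDeficientBox P i₀ Y m j n ω} =
      ⋃ u : Fin n → S, {ω | 0 < boxSize P i₀ u ∧ ballCount Y m u ω < j} := by
    ext ω
    simp [HasDeficientBox]
  rw [hsub]
  refine (measure_iUnion_fintype_le _ _).trans ?_
  calc ∑ u : Fin n → S, μ {ω | 0 < boxSize P i₀ u ∧ ballCount Y m u ω < j}
      ≤ ∑ _u : Fin n → S, ENNReal.ofReal (j * Real.exp (-(q * (m / j : ℕ)))) := by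
        refine Finset.sum_le_sum fun u _ => ?_
        by_cases hu : 0 < boxSize P i₀ u
        · simp only [hu, true_and]
          refine (measure_ballCount_lt_le hP hY hindep u m j).trans ?_
          rw [ENNReal.ofReal_mul (Nat.cast_nonneg _), ENNReal.ofReal_natCast]
          gcongr
          exact hq u hu
        · simp [hu]
    _ = _ := by
        rw [Finset.sum_const, Finset.card_univ, Fintype.card_fun, Fintype.card_fin,
          ENNReal.ofReal_mul (p := (Fintype.card S : ℝ) ^ n) (by positivity), nsmul_eq_mul,
          ENNReal.ofReal_pow (by positivity), ENNReal.ofReal_natCast]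
        push_cast
        rfl

end Events

/-- Bounding `exp x` below by `x ^ k / k!` with `exp δ ^ k > 2 K` leaves a geometric series of ratio
at most `1/2`. -/
lemma summable_pow_mul_exp_neg_exp {K a δ : ℝ} (hK : 0 ≤ K) (ha : 0 < a) (hδ : 0 < δ) :
    Summable fun n : ℕ => K ^ n * Real.exp (-(a * Real.exp (n * δ))) := by
  obtain ⟨k, hk⟩ := pow_unbounded_of_one_lt (2 * K) (Real.one_lt_exp_iff.2 hδ)
  refine Summable.of_nonneg_of_le (fun n => by positivity) (fun n => ?_)
    ((summable_geometric_of_lt_one (by norm_num) (by norm_num : (1 / 2 : ℝ) < 1)).mul_left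
      (k.factorial / a ^ k))
  have hx : 0 < a * Real.exp (n * δ) := by positivity
  have h1 := Real.pow_div_factorial_le_exp _ hx.le k
  have h2 : Real.exp (-(a * Real.exp (n * δ))) ≤ k.factorial / (a * Real.exp (n * δ)) ^ k := by
    rw [Real.exp_neg, ← inv_div]
    exact inv_anti₀ (by positivity) h1
  have h3 : (a * Real.exp (n * δ)) ^ k = a ^ k * (Real.exp δ ^ k) ^ n := by
    rw [mul_pow, Real.exp_nat_mul, ← pow_mul, ← pow_mul, mul_comm n k]
  have hE : 0 < Real.exp δ ^ k := by positivity
  have h4 : K / Real.exp δ ^ k ≤ 1 / 2 := by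
    rw [div_le_div_iff₀ hE two_pos]
    linarith
  calc K ^ n * Real.exp (-(a * Real.exp (n * δ)))
      ≤ K ^ n * (k.factorial / (a ^ k * (Real.exp δ ^ k) ^ n)) := by
        rw [← h3]
        exact mul_le_mul_of_nonneg_left h2 (by positivity)
    _ = k.factorial / a ^ k * (K / Real.exp δ ^ k) ^ n := by
        rw [div_pow]
        field_simp
    _ ≤ k.factorial / a ^ k * (1 / 2) ^ n := by gcongr

lemma ae_eventually_notMem_of_summable {Ω : Type*} [MeasurableSpace Ω] {μ : Measure Ω}
    {s : ℕ → Set Ω} {g : ℕ → ℝ} (hg : Summable g) (h : ∀ n, μ (s n) ≤ ENNReal.ofReal (g n)) :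
    ∀ᵐ ω ∂μ, ∀ᶠ n in atTop, ω ∉ s n :=
  ae_eventually_notMem (ne_top_of_le_ne_top hg.tsum_ofReal_ne_top (ENNReal.tsum_le_tsum h))

section AlmostSure

variable {S Ω : Type*} [DecidableEq S] [MeasurableSpace S] [MeasurableSingletonClass S]
  {P : Matrix S S ℝ} {i₀ : S} [MeasurableSpace Ω] {μ : Measure Ω} [IsProbabilityMeasure μ]
  {Y : ℕ → ℕ → Ω → S} {c Λ δ : ℝ} {j : ℕ}

theorem ae_eventually_not_hasDeficientBox [Fintype S] (hP : ∀ i j, 0 ≤ P i j)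
    (hY : ∀ b, IsMarkovChain (Y b) P i₀ μ)
    (hindep : iIndepFun (fun (b : ℕ) (ω : Ω) (n : ℕ) => Y b n ω) μ) (hc : 0 < c) (hΛ : 0 ≤ Λ)
    (hδ : 0 < δ) (hj : 1 ≤ j) (hsize : ∀ (n : ℕ) (u : Fin n → S), 0 < boxSize P i₀ u →
      c * Real.exp (-(n * Λ)) ≤ boxSize P i₀ u) :
    ∀ᵐ ω ∂μ, ∀ᶠ n : ℕ in atTop,
      ¬ HasDeficientBox P i₀ Y ⌈Real.exp (n * (Λ + δ))⌉₊ j n ω := by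
  have hj0 : (0 : ℝ) < j := by exact_mod_cast hj
  refine ae_eventually_notMem_of_summable
    (s := fun n => {ω | HasDeficientBox P i₀ Y ⌈Real.exp (n * (Λ + δ))⌉₊ j n ω})
    ((summable_pow_mul_exp_neg_exp (K := Fintype.card S) (Nat.cast_nonneg _) (div_pos hc hj0)
      hδ).mul_left (j * Real.exp c)) fun n => ?_
  refine (measure_hasDeficientBox_le hP hY hindep (hsize n) _ j).trans
    (ENNReal.ofReal_le_ofReal ?_)
  set M := ⌈Real.exp (n * (Λ + δ))⌉₊
  -- Rounding `M / j` down loses at most `1`, which becomes the harmless factor `exp c` below.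
  have h1 : Real.exp (n * (Λ + δ)) / j - 1 ≤ (M / j : ℕ) := by
    have h2 : M < j * (M / j + 1) := Nat.lt_mul_div_succ M hj
    have h3 : (M : ℝ) < j * ((M / j : ℕ) + 1) := by exact_mod_cast h2
    have h4 : Real.exp (n * (Λ + δ)) ≤ M := Nat.le_ceil _
    rw [sub_le_iff_le_add, div_le_iff₀ hj0]
    linarith
  have h2 : c / j * Real.exp (n * δ) - c ≤ c * Real.exp (-(n * Λ)) * (M / j : ℕ) := by
    have h3 := mul_le_mul_of_nonneg_left h1 (show 0 ≤ c * Real.exp (-(n * Λ)) by positivity)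
    have h4 : Real.exp (-(n * Λ)) * Real.exp (n * (Λ + δ)) = Real.exp (n * δ) := by
      rw [← Real.exp_add]; ring_nf
    have h5 : Real.exp (-(n * Λ)) ≤ 1 := Real.exp_le_one_iff.2 (neg_nonpos.2 (by positivity))
    have h6 := mul_le_mul_of_nonneg_left h5 hc.le
    have h7 : c * Real.exp (-(n * Λ)) * (Real.exp (n * (Λ + δ)) / j - 1)
        = c / j * Real.exp (n * δ) - c * Real.exp (-(n * Λ)) := by
      rw [← h4]; ring
    linarith
  have h3 : Real.exp (-(c * Real.exp (-(n * Λ)) * (M / j : ℕ))) ≤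
      Real.exp c * Real.exp (-(c / j * Real.exp (n * δ))) := by
    rw [← Real.exp_add]
    exact Real.exp_le_exp.2 (by linarith)
  calc _ ≤ (Fintype.card S : ℝ) ^ n *
        (j * (Real.exp c * Real.exp (-(c / j * Real.exp (n * δ))))) := by gcongr
    _ = _ := by ring

/-- First moment: `exp (n (Λ - δ))` balls and a box of size at most `c * exp (-n Λ)` give a summable
chance of any hit. The empty box is deficient for every `j ≥ 1`. -/
theorem ae_eventually_hasDeficientBox
    (hY : ∀ b, IsMarkovChain (Y b) P i₀ μ) (hδ : 0 < δ) (hδΛ : δ ≤ Λ) (hj : 1 ≤ j)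
    (hsize : ∀ n : ℕ, ∃ u : Fin n → S, 0 < boxSize P i₀ u ∧
      boxSize P i₀ u ≤ c * Real.exp (-(n * Λ))) :
    ∀ᵐ ω ∂μ, ∀ᶠ n : ℕ in atTop,
      HasDeficientBox P i₀ Y ⌈Real.exp (n * (Λ - δ))⌉₊ j n ω := by
  choose u hu0 hu using hsize
  have hsum : Summable fun n : ℕ => 2 * c * Real.exp (n * (-δ)) :=
    (Real.summable_exp_nat_mul_iff.2 (neg_lt_zero.2 hδ)).mul_left _
  have := ae_eventually_notMem_of_summable (μ := μ)
    (s := fun n => ⋃ b ∈ Finset.range ⌈Real.exp (n * (Λ - δ))⌉₊, boxEvent Y b (u n)) hsum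
    fun n => by
      refine (measure_biUnion_finset_le _ _).trans ?_
      simp only [measure_boxEvent (hY _), Finset.sum_const, Finset.card_range, nsmul_eq_mul]
      rw [← ENNReal.ofReal_natCast, ← ENNReal.ofReal_mul (Nat.cast_nonneg _)]
      refine ENNReal.ofReal_le_ofReal ?_
      -- Ensures that rounding up at most doubles the number of balls.
      have h1 : (1 : ℝ) ≤ Real.exp (n * (Λ - δ)) :=
        Real.one_le_exp (mul_nonneg n.cast_nonneg (sub_nonneg.2 hδΛ))
      have h2 := (Nat.ceil_lt_add_one (Real.exp_pos (n * (Λ - δ))).le).le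
      calc _ ≤ 2 * Real.exp (n * (Λ - δ)) * (c * Real.exp (-(n * Λ))) :=
            mul_le_mul (by linarith) (hu n) (hu0 n).le (by positivity)
        _ = 2 * c * (Real.exp (n * (Λ - δ)) * Real.exp (-(n * Λ))) := by ring
        _ = _ := by
          rw [← Real.exp_add]
          ring_nf
  filter_upwards [this] with ω hω
  filter_upwards [hω] with n hn
  refine ⟨u n, hu0 n, ?_⟩
  suffices ballCount Y ⌈Real.exp (n * (Λ - δ))⌉₊ (u n) ω = 0 by omega
  simp only [Set.mem_iUnion, not_exists] at hn
  rw [ballCount, Finset.card_eq_zero, Finset.eq_empty_iff_forall_notMem]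
  intro b hb
  simp only [Finset.mem_filter] at hb
  exact hn b hb.1 hb.2

end AlmostSure

/-! ### From generations `n` to numbers of balls `m`. -/

section Asymptotics

variable {S Ω : Type*} [DecidableEq S] {P : Matrix S S ℝ} {i₀ : S} {Y : ℕ → ℕ → Ω → S} {j : ℕ}
  {ω : Ω} {κ l : ℝ}

lemma tendsto_log_natCast_div_atTop (hκ : 0 < κ) :
    Tendsto (fun m : ℕ => Real.log m / κ) atTop atTop :=
  (Real.tendsto_log_atTop.comp tendsto_natCast_atTop_atTop).atTop_div_const hκ

omit [DecidableEq S] in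
-- With `n = ⌈log m / κ⌉` one has `m ≤ exp (n κ)`, and fewer balls preserve deficiency; the lower
-- bound uses the floor instead.
lemma eventually_saturationLevel_le (hκ : 0 < κ)
    (h : ∀ᶠ n : ℕ in atTop, HasDeficientBox P i₀ Y ⌈Real.exp (n * κ)⌉₊ j n ω) :
    ∀ᶠ m : ℕ in atTop, (saturationLevel P i₀ Y m j ω : ℝ) ≤ Real.log m / κ + 1 := by
  have hn : Tendsto (fun m : ℕ => ⌈Real.log m / κ⌉₊) atTop atTop :=
    tendsto_nat_ceil_atTop.comp (tendsto_log_natCast_div_atTop hκ)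
  filter_upwards [hn.eventually h, eventually_ge_atTop 1] with m hm hm1
  have hm0 : (0 : ℝ) < m := by exact_mod_cast hm1
  have hlog : 0 ≤ Real.log m / κ := div_nonneg (Real.log_natCast_nonneg m) hκ.le
  have hle : m ≤ ⌈Real.exp (⌈Real.log m / κ⌉₊ * κ)⌉₊ := by
    have h1 : Real.log m ≤ ⌈Real.log m / κ⌉₊ * κ := (div_le_iff₀ hκ).1 (Nat.le_ceil _)
    have h2 := ((Real.log_le_iff_le_exp hm0).1 h1).trans (Nat.le_ceil _)
    exact_mod_cast h2
  have h3 : (saturationLevel P i₀ Y m j ω : ℝ) ≤ ⌈Real.log m / κ⌉₊ := by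
    exact_mod_cast saturationLevel_le (hm.anti_balls hle)
  exact h3.trans (Nat.ceil_lt_add_one hlog).le

lemma eventually_le_saturationLevel [Fintype S] (hP : P ∈ rowStochastic ℝ S) (hκ : 0 < κ)
    (hex : ∀ m, ∃ n, HasDeficientBox P i₀ Y m j n ω)
    (h : ∀ᶠ n : ℕ in atTop, ¬ HasDeficientBox P i₀ Y ⌈Real.exp (n * κ)⌉₊ j n ω) :
    ∀ᶠ m : ℕ in atTop, Real.log m / κ - 1 ≤ saturationLevel P i₀ Y m j ω := by
  have hn : Tendsto (fun m : ℕ => ⌊Real.log m / κ⌋₊) atTop atTop :=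
    tendsto_nat_floor_atTop.comp (tendsto_log_natCast_div_atTop hκ)
  filter_upwards [hn.eventually h, eventually_ge_atTop 1] with m hm hm1
  have hm0 : (0 : ℝ) < m := by exact_mod_cast hm1
  have hlog : 0 ≤ Real.log m / κ := div_nonneg (Real.log_natCast_nonneg m) hκ.le
  have hle : ⌈Real.exp (⌊Real.log m / κ⌋₊ * κ)⌉₊ ≤ m := by
    rw [Nat.ceil_le, ← Real.le_log_iff_exp_le hm0, ← le_div_iff₀ hκ]
    exact Nat.floor_le hlog
  have h1 := lt_saturationLevel hP (hex m) fun hd => hm (hd.anti_balls hle)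
  have h2 : (⌊Real.log m / κ⌋₊ : ℝ) ≤ saturationLevel P i₀ Y m j ω := by exact_mod_cast h1.le
  linarith [Nat.lt_floor_add_one (Real.log m / κ)]

lemma tendsto_div_log_of_eventually_bounds {G : ℕ → ℝ} {κ₁ κ₂ : ℕ → ℝ} (hl : 0 < l)
    (hκ₁ : Tendsto κ₁ atTop (𝓝 l)) (hκ₂ : Tendsto κ₂ atTop (𝓝 l))
    (hlow : ∀ k, ∀ᶠ m : ℕ in atTop, Real.log m / κ₁ k - 1 ≤ G m)
    (hup : ∀ k, ∀ᶠ m : ℕ in atTop, G m ≤ Real.log m / κ₂ k + 1) :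
    Tendsto (fun m : ℕ => G m / Real.log m) atTop (𝓝 l⁻¹) := by
  have hlog : Tendsto (fun m : ℕ => Real.log (m : ℝ)) atTop atTop :=
    Real.tendsto_log_atTop.comp tendsto_natCast_atTop_atTop
  have hinv : Tendsto (fun m : ℕ => (Real.log (m : ℝ))⁻¹) atTop (𝓝 0) :=
    tendsto_inv_atTop_zero.comp hlog
  refine tendsto_order.2 ⟨fun a ha => ?_, fun a ha => ?_⟩
  · obtain ⟨k, hk⟩ := ((hκ₁.inv₀ hl.ne').eventually (lt_mem_nhds ha)).exists
    filter_upwards [hlow k, hlog.eventually_gt_atTop 0,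
      hinv.eventually (gt_mem_nhds (sub_pos.2 hk))] with m h1 h2 h3
    have h4 : Real.log m * (κ₁ k)⁻¹ - 1 ≤ G m := h1
    have h5 : (κ₁ k)⁻¹ - (Real.log (m : ℝ))⁻¹ ≤ G m / Real.log m := by
      rw [le_div_iff₀ h2, sub_mul, inv_mul_cancel₀ h2.ne']
      linarith
    linarith
  · obtain ⟨k, hk⟩ := ((hκ₂.inv₀ hl.ne').eventually (gt_mem_nhds ha)).exists
    filter_upwards [hup k, hlog.eventually_gt_atTop 0,
      hinv.eventually (gt_mem_nhds (sub_pos.2 hk))] with m h1 h2 h3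
    have h4 : G m ≤ Real.log m * (κ₂ k)⁻¹ + 1 := h1
    have h5 : G m / Real.log m ≤ (κ₂ k)⁻¹ + (Real.log (m : ℝ))⁻¹ := by
      rw [div_le_iff₀ h2, add_mul, inv_mul_cancel₀ h2.ne']
      linarith
    linarith

end Asymptotics

end MarkovTrie

/-! ### Assembly of the almost sure limit. -/

theorem theorem3 {S : Type*} [Fintype S] [DecidableEq S] [Nontrivial S]
    [MeasurableSpace S] [MeasurableSingletonClass S]
    (P : Matrix S S ℝ) (hP : P ∈ Matrix.rowStochastic ℝ S)
    (hirr : P.IsIrreducible) (haper : MarkovTrie.IsAperiodic P) (i₀ : S)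
    {Ω : Type*} [MeasurableSpace Ω] (μ : Measure Ω) [IsProbabilityMeasure μ]
    (Y : ℕ → ℕ → Ω → S)
    (hY : ∀ b, MarkovTrie.IsMarkovChain (Y b) P i₀ μ)
    (hindep : iIndepFun (fun (b : ℕ) (ω : Ω) (n : ℕ) => Y b n ω) μ) :
    ∃ (ρ : ℝ → ℝ) (C : ℝ),
      (∀ θ : ℝ, MarkovTrie.IsMaxModulusEigenvalue (MarkovTrie.powMatrix P θ) (ρ θ : ℂ)) ∧
      Differentiable ℝ ρ ∧
      0 < C ∧
      Tendsto (fun θ : ℝ => ρ θ / (-deriv ρ θ)) atBot (𝓝 C) ∧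
      ∀ j : ℕ, 1 ≤ j →
        (∀ (m : ℕ) (ω : Ω), ∃ n : ℕ, MarkovTrie.HasDeficientBox P i₀ Y m j n ω) ∧
        ∀ᵐ ω ∂μ, Tendsto
          (fun m : ℕ => (MarkovTrie.saturationLevel P i₀ Y m j ω : ℝ) / Real.log (m : ℝ))
          atTop (𝓝 C) := by
  have hprim := hirr.isPrimitive haper
  have hP0 := hprim.nonneg
  obtain ⟨ρ, v, w, l, hperron, hdiff, hl, hlim, hρ0, hslope⟩ :=
    MarkovTrie.exists_asymptotic_slope hP hprim
  have hex : ∀ j, 1 ≤ j → ∀ (m : ℕ) (ω : Ω), ∃ n, MarkovTrie.HasDeficientBox P i₀ Y m j n ω :=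
    fun j hj m ω => MarkovTrie.exists_hasDeficientBox hP0 (hperron 0) hρ0 hj
  refine ⟨ρ, l⁻¹, fun θ => (hperron θ).isMaxModulusEigenvalue
    (MarkovTrie.powMatrix_isPrimitive hprim θ), hdiff, inv_pos.2 hl, hlim,
    fun j hj => ⟨hex j hj, ?_⟩⟩
  -- A countable family of margins keeps the exceptional set null. Each `ε k` is spent twice, on the
  -- box-size exponent and on Borel–Cantelli; `ε k ≤ l / 4` keeps `l - 2 ε k` positive.
  set ε : ℕ → ℝ := fun k => l / 4 * (1 / ((k : ℝ) + 1)) with hε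
  have hε0 : ∀ k, 0 < ε k := fun k => by positivity
  have hε1 : ∀ k, ε k ≤ l / 4 := fun k => by
    refine mul_le_of_le_one_right (by positivity) ?_
    rw [div_le_one (by positivity)]
    linarith [(Nat.cast_nonneg k : (0 : ℝ) ≤ k)]
  have hεlim : Tendsto ε atTop (𝓝 0) := by
    simpa only [mul_zero] using
      (tendsto_one_div_add_atTop_nhds_zero_nat (𝕜 := ℝ)).const_mul (l / 4)
  have hup : ∀ k, ∀ᵐ ω ∂μ, ∀ᶠ n : ℕ in atTop,
      MarkovTrie.HasDeficientBox P i₀ Y ⌈Real.exp (n * (l - ε k - ε k))⌉₊ j n ω := fun k => by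
    obtain ⟨s, hs, -, h2⟩ := hslope (ε k) (hε0 k)
    obtain ⟨c, -, hsize⟩ := MarkovTrie.exists_boxSize_le hP0 hs (hperron (-s)) h2
    exact MarkovTrie.ae_eventually_hasDeficientBox hY (hε0 k) (by linarith [hε1 k]) hj
      fun n => hsize n i₀
  have hlow : ∀ k, ∀ᵐ ω ∂μ, ∀ᶠ n : ℕ in atTop,
      ¬ MarkovTrie.HasDeficientBox P i₀ Y ⌈Real.exp (n * (l + ε k + ε k))⌉₊ j n ω := fun k => by
    obtain ⟨s, hs, h1, -⟩ := hslope (ε k) (hε0 k)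
    obtain ⟨c, hc, hsize⟩ := MarkovTrie.exists_le_boxSize hP0 hs (hperron (-s)) h1
    exact MarkovTrie.ae_eventually_not_hasDeficientBox hP0 hY hindep hc
      (add_pos hl (hε0 k)).le (hε0 k) hj fun n u hu => hsize n i₀ u hu
  filter_upwards [ae_all_iff.2 hup, ae_all_iff.2 hlow] with ω hω1 hω2
  refine MarkovTrie.tendsto_div_log_of_eventually_bounds (κ₁ := fun k => l + ε k + ε k)
    (κ₂ := fun k => l - ε k - ε k) hl ?_ ?_ (fun k => ?_) fun k => ?_
  · simpa using (hεlim.const_add l).add hεlim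
  · simpa using (hεlim.const_sub l).sub hεlim
  · exact MarkovTrie.eventually_le_saturationLevel hP (by linarith [hε0 k])
      (fun m => hex j hj m ω) (hω2 k)
  · exact MarkovTrie.eventually_saturationLevel_le (by linarith [hε1 k]) (hω1 k)
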